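/- Let $d\ge 1$, $L>0$, and let $\mathbb T=\mathbb T_L^d=(\mathbb R/L\mathbb Z)^d$ be the torus with Lebesgue measure. For $a<L$ let $\mathscr V$ be the set of $V\in L^1(\mathbb T)$ (real valued) with $V^-\in L^\infty$, $V(-x)=V(x)$ a.e. and $V(x)=0$ for a.e. $x$ with $|x|>a$, where $|x|$ is the Euclidean distance from $x$ to $0$ in $\mathbb T$. Let $\mathscr P$ be the set of probability densities on $\mathbb T$, let $\rho_0=L^{-d}$ be the uniform density, and for $\theta\ge 0$, $\rho\in\mathscr P$ put $$\mathcal F_\theta(\rho)=\int_{\mathbb T}\rho\log\rho\,dx+\tfrac12\theta L^d\int_{\mathbb T\times\mathbb T}V(x-y)\rho(x)\rho(y)\,dx\,dy\in(-\infty,+\infty]$$ (each integral is $+\infty$ if its integrand is not integrable, and $0\cdot\infty=0$). A minimizer of $\mathcal F_\theta$ is a $\rho\in\mathscr P$ with $\mathcal F_\theta(\rho)\le\mathcal F_\theta(\sigma)$ for all $\sigma\in\mathscr P$; densities are identified if they agree a.e. For a wave vector $k\in\frac{2\pi}{L}\mathbb Z^d$ let $\hat V(k)=\int_{\mathbb T}V(x)e^{-ik\cdot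 x}\,dx$, which is real. Call $V\in\mathscr V$ of positive type if $\int_{\mathbb T\times\mathbb T} V(x-y)h(x)h(y)\,dx\,dy\ge 0$ for every $h\in L^1(\mathbb T)$ with $\int_{\mathbb T} h\,dx=0$ for which $V(x-y)h(x)h(y)$ is integrable on $\mathbb T\times\mathbb T$, and let $\mathscr V_N$ be the set of $V\in\mathscr V$ that are not of positive type. (1) Let $V\in\mathscr V_N$. Then there is a minimizing wave vector, that is, a $k^\sharp\neq 0$ with $\hat V(k^\sharp)\le\hat V(k)$ for all wave vectors $k\ne0$. For every such $k^\sharp$ one has $\hat V(k^\sharp)<0$ and, with $\theta^\sharp:=|\hat V(k^\sharp)|^{-1}$, the following holds for every $\theta>\theta^\sharp$: there is a minimizer $\rho\ne\rho_0$ of $\mathcal F_\theta$; $\rho_0$ is not a minimizer of $\mathcal F_\theta$; and there is $\varepsilon_0>0$ such that for all $0<\varepsilon<\varepsilon_0$ the function $\rho_0\,(1+\varepsilon\cos(k^\sharp\cdot x))$ belongs to $\mathscr P$ and has $\mathcal F_\theta\bigl(\rho_0(1+\varepsilon\cos(k^\sharp\cdot x))\bigr)<\mathcal F_\theta(\rho_0)$.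 (2) Let $V\in\mathscr V$. Then $V\in\mathscr V_N$ if and only if there is a non-trivial phase, that is, if and only if for some $\theta\ge 0$ the functional $\mathcal F_\theta$ has a minimizer $\rho\neq\rho_0$. -/

import Mathlib

open MeasureTheory

namespace McKeanVlasov

noncomputable section

/-- The `d`-dimensional torus of length scale `L`. Its `volume` is the product Lebesgue measure,
of total mass `L ^ d`. -/
abbrev Torus (d : ℕ) (L : ℝ) : Type := Fin d → AddCircle L

variable {d : ℕ} {L : ℝ}

/-- Euclidean (geodesic) distance of a point of the torus to the origin; the norm of `AddCircle L`
is the distance to `0` on the circle of length `L`. -/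
def euclidLength (x : Torus d L) : ℝ := Real.sqrt (∑ i, ‖x i‖ ^ 2)

/-- The plane wave `x ↦ exp (i k · x)` with wave vector `k = (2 π / L) n`, `n ∈ ℤ ^ d`. -/
def planeWave (n : Fin d → ℤ) (x : Torus d L) : ℂ := ∏ i, fourier (n i) (x i)

variable [Fact (0 < L)]

/-- The interactions of range `a`: integrable, with essentially bounded negative part, symmetric,
and vanishing at distance greater than `a` from the origin. -/
structure IsInteraction (a : ℝ) (V : Torus d L → ℝ) : Prop where
  integrable : Integrable V volume
  negPart_bounded : MemLp (fun x => max (-V x) 0) ⊤ volume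
  symmetric : ∀ᵐ x ∂(volume : Measure (Torus d L)), V (-x) = V x
  finite_range : ∀ᵐ x ∂(volume : Measure (Torus d L)), a < euclidLength x → V x = 0

/-- The integrand of the bilinear energy functional. -/
def energyDensity (V f g : Torus d L → ℝ) (p : Torus d L × Torus d L) : ℝ :=
  V (p.1 - p.2) * f p.1 * g p.2

/-- The bilinear energy `∫∫ V(x - y) f(x) g(y) dx dy` (for an integrable integrand). -/
def energy (V f g : Torus d L → ℝ) : ℝ := ∫ p, energyDensity V f g p

/-- The Fourier transform `∫ V(x) exp (- i k · x) dx` at the wave vector `k = (2 π / L) n`. -/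
def fourierTransform (V : Torus d L → ℝ) (n : Fin d → ℤ) : ℂ :=
  ∫ x, (V x : ℂ) * planeWave (-n) x

/-- The Fourier transform of a symmetric interaction is real; this is its value as a real number. -/
def fourierReal (V : Torus d L → ℝ) (n : Fin d → ℤ) : ℝ := (fourierTransform V n).re

/-- `V` is of positive type on the differences of densities, that is on the integrable functions
`h` of mean zero. (The energy of `h` is considered whenever it is well defined.) -/
def IsPositiveType (V : Torus d L → ℝ) : Prop :=
  ∀ h : Torus d L → ℝ, Integrable h volume → ∫ x, h x = 0 →
    Integrable (energyDensity V h h) volume → 0 ≤ energy V h h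

/-- The interactions that are not of positive type. -/
def IsNonPositiveInteraction (a : ℝ) (V : Torus d L → ℝ) : Prop :=
  IsInteraction a V ∧ ¬ IsPositiveType V

/-- Probability densities on the torus. -/
structure IsDensity (ρ : Torus d L → ℝ) : Prop where
  integrable : Integrable ρ volume
  nonneg : 0 ≤ᵐ[volume] ρ
  integral_eq_one : ∫ x, ρ x = 1

/-- The uniform density `ρ₀ = L ^ (-d)`. -/
def uniformDensity (d : ℕ) (L : ℝ) : Torus d L → ℝ := fun _ => (L ^ d)⁻¹

open Classical in
/-- `∫ ρ log ρ`, as an extended real number. The negative part of `ρ log ρ` is bounded, so the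
integral is `+∞` when `ρ log ρ` is not integrable. -/
def entropy (ρ : Torus d L → ℝ) : EReal :=
  if Integrable (fun x => ρ x * Real.log (ρ x)) volume then
    ((∫ x, ρ x * Real.log (ρ x) : ℝ) : EReal)
  else ⊤

open Classical in
/-- `∫∫ V(x - y) ρ(x) ρ(y) dx dy` for a density `ρ`, as an extended real number. As `V` is bounded
below, the negative part of the integrand is integrable, so the integral is `+∞` when the integrand
is not integrable. -/
def selfEnergy (V ρ : Torus d L → ℝ) : EReal :=
  if Integrable (energyDensity V ρ ρ) volume then ((energy V ρ ρ : ℝ) : EReal) else ⊤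

/-- The free energy `∫ ρ log ρ + (θ / 2) L ^ d ∫∫ V(x - y) ρ(x) ρ(y) dx dy`, for `θ ≥ 0`. -/
def freeEnergy (V : Torus d L → ℝ) (θ : ℝ) (ρ : Torus d L → ℝ) : EReal :=
  entropy ρ + ((θ / 2 * L ^ d : ℝ) : EReal) * selfEnergy V ρ

/-- `ρ` minimizes the free energy among all probability densities. -/
def IsMinimizer (V : Torus d L → ℝ) (θ : ℝ) (ρ : Torus d L → ℝ) : Prop :=
  IsDensity ρ ∧ ∀ σ : Torus d L → ℝ, IsDensity σ → freeEnergy V θ ρ ≤ freeEnergy V θ σ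

/-- There is a minimizer of the free energy which is not (a.e. equal to) the uniform density. -/
def HasNontrivialMinimizer (V : Torus d L → ℝ) (θ : ℝ) : Prop :=
  ∃ ρ : Torus d L → ℝ, IsMinimizer V θ ρ ∧ ¬ (ρ =ᵐ[volume] uniformDensity d L)

/-- `k = (2 π / L) n` minimizes the Fourier transform of `V` among the nonzero wave vectors. -/
def IsMinimizingWaveVector (V : Torus d L → ℝ) (n : Fin d → ℤ) : Prop :=
  n ≠ 0 ∧ ∀ m : Fin d → ℤ, m ≠ 0 → fourierReal V n ≤ fourierReal V m

/-- The parameter value `θ♯`, computed from a minimizing wave vector. -/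
def thetaSharp (V : Torus d L → ℝ) (n : Fin d → ℤ) : ℝ := |fourierReal V n|⁻¹

/-- The perturbation `ρ₀ (1 + ε cos (k · x))` of the uniform density, `k = (2 π / L) n`. -/
def planeWavePerturbation (n : Fin d → ℤ) (ε : ℝ) : Torus d L → ℝ :=
  fun x => uniformDensity d L x * (1 + ε * (planeWave n x).re)

end

end McKeanVlasov

open McKeanVlasov

/-! The free energy is a strictly convex entropy plus a quadratic form that the Fourier transform of
`V` diagonalizes. If that transform is nonnegative off zero, `V` is of positive type
(`isPositiveType_of_fourierReal_nonneg`). So an interaction not of positive type has a negative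
coefficient at some nonzero wave vector, and by Riemann–Lebesgue the least such coefficient is
attained. Perturbing the uniform density by `ε` times that wave changes the free energy by at most
`ε ^ 2 / 4 * (1 + θ * fourierReal V n)` plus a cubic error, which is negative for small `ε` above
the threshold (`realFreeEnergy_planeWavePerturbation_le`).

A nontrivial minimizer then exists as soon as some minimizer exists. Although `V` may be unbounded
above, mass sitting above a high level `C` can be moved to a region of low density without raising
the free energy (`exists_isBoundedDensity_le`). Among densities bounded by `C` the entropy is
uniformly convex, and the energy of differences vanishes once the Fourier coefficients converge.
Hence minimizing sequences are Cauchy in mean square along a subsequence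
(`exists_isBoundedDensity_minimizer`).

Conversely, for positive type the uniform density minimizes both terms, and strict convexity of the
entropy excludes any other minimizer (`ae_eq_uniformDensity_of_isPositiveType`). -/

namespace McKeanVlasov

noncomputable section

open scoped ComplexConjugate

variable {d : ℕ} {L : ℝ}

/-! ### Fourier analysis on the torus -/

lemma continuous_planeWave (n : Fin d → ℤ) : Continuous (planeWave n : Torus d L → ℂ) := by
  unfold planeWave
  fun_prop

lemma norm_planeWave (n : Fin d → ℤ) (x : Torus d L) : ‖planeWave n x‖ = 1 := by
  rw [planeWave, norm_prod]
  exact Finset.prod_eq_one fun i _ => by rw [fourier_apply]; exact Circle.norm_coe _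

lemma abs_planeWave_re_le (n : Fin d → ℤ) (x : Torus d L) : |(planeWave n x).re| ≤ 1 :=
  (Complex.abs_re_le_norm _).trans (norm_planeWave n x).le

lemma planeWave_neg (n : Fin d → ℤ) (x : Torus d L) :
    planeWave (-n) x = conj (planeWave n x) := by
  simp only [planeWave, Pi.neg_apply, fourier_neg, map_prod]

lemma planeWave_add (n m : Fin d → ℤ) (x : Torus d L) :
    planeWave (n + m) x = planeWave n x * planeWave m x := by
  simp only [planeWave, Pi.add_apply, fourier_add, ← Finset.prod_mul_distrib]

lemma planeWave_zero (x : Torus d L) : planeWave 0 x = 1 := by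
  simp [planeWave]

lemma planeWave_apply_sub (n : Fin d → ℤ) (x y : Torus d L) :
    planeWave n (x - y) = planeWave n x * conj (planeWave n y) := by
  simp only [planeWave, map_prod, ← Finset.prod_mul_distrib, Pi.sub_apply]
  refine Finset.prod_congr rfl fun i _ => ?_
  rw [← fourier_neg, fourier_apply, fourier_apply, fourier_apply, smul_sub, neg_smul,
    sub_eq_add_neg, AddCircle.toCircle_add, Circle.coe_mul]

/-- The trigonometric polynomial with coefficients `c`. -/
def trigPoly (c : (Fin d → ℤ) →₀ ℂ) (x : Torus d L) : ℂ := c.sum fun n z => z * planeWave n x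

lemma continuous_trigPoly (c : (Fin d → ℤ) →₀ ℂ) : Continuous (trigPoly c : Torus d L → ℂ) := by
  unfold trigPoly Finsupp.sum
  exact continuous_finsetSum _ fun n _ => continuous_const.mul (continuous_planeWave n)

lemma _root_.MeasureTheory.Integrable.complexOfReal {α : Type*} {m : MeasurableSpace α}
    {μ : Measure α} {f : α → ℝ} (hf : Integrable f μ) : Integrable (fun x => (f x : ℂ)) μ :=
  hf.ofReal

variable [Fact (0 < L)]

instance : (volume : Measure (Torus d L)).IsNegInvariant := by
  have : (volume : Measure (AddCircle L)).IsNegInvariant := inferInstance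
  exact inferInstanceAs (Measure.pi fun _ => volume).IsNegInvariant

lemma volume_real_univ : (volume : Measure (Torus d L)).real Set.univ = L ^ d := by
  have hL : (0 : ℝ) < L := Fact.out
  rw [measureReal_def, volume_pi, Measure.pi_univ]
  simp [AddCircle.measure_univ, ENNReal.toReal_ofReal hL.le]

/-- Translation by `L / 2 / n` flips the sign of the character but preserves the measure. -/
lemma integral_fourier_eq_zero {n : ℤ} (hn : n ≠ 0) : ∫ x : AddCircle L, fourier n x = 0 := by
  have hL : (0 : ℝ) < L := Fact.out
  refine integral_eq_zero_of_add_right_eq_neg (μ := volume) (g := ((L / 2 / n : ℝ) : AddCircle L))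
    fun x => ?_
  exact fourier_add_half_inv_index hn hL x

lemma integral_planeWave {n : Fin d → ℤ} (hn : n ≠ 0) :
    ∫ x : Torus d L, planeWave n x = 0 := by
  obtain ⟨i, hi⟩ := Function.ne_iff.mp hn
  unfold planeWave
  rw [integral_fintype_prod_volume_eq_prod (fun i (x : AddCircle L) => (fourier (n i) x : ℂ))]
  exact Finset.prod_eq_zero (Finset.mem_univ i) (integral_fourier_eq_zero hi)

lemma integrable_planeWave (n : Fin d → ℤ) :
    Integrable (planeWave n : Torus d L → ℂ) volume :=
  (continuous_planeWave n).integrable_of_hasCompactSupport (HasCompactSupport.of_compactSpace _)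

lemma integral_planeWave_mul_conj (n m : Fin d → ℤ) :
    ∫ x : Torus d L, planeWave n x * conj (planeWave m x) = if n = m then (L : ℂ) ^ d else 0 := by
  simp_rw [← planeWave_neg, ← planeWave_add]
  split_ifs with h
  · subst h
    simp [planeWave_zero, volume_real_univ]
  · exact integral_planeWave (by rwa [← sub_eq_add_neg, sub_ne_zero])

lemma integrable_trigPoly (c : (Fin d → ℤ) →₀ ℂ) :
    Integrable (trigPoly c : Torus d L → ℂ) volume :=
  (continuous_trigPoly c).integrable_of_hasCompactSupport (HasCompactSupport.of_compactSpace _)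

/-- Stone–Weierstrass, applied to the star algebra generated by the plane waves. -/
lemma exists_trigPoly_uniform (g : C(Torus d L, ℂ)) {ε : ℝ} (hε : 0 < ε) :
    ∃ c : (Fin d → ℤ) →₀ ℂ, ∀ x, ‖g x - trigPoly c x‖ ≤ ε := by
  classical
  let e : (Fin d → ℤ) → C(Torus d L, ℂ) := fun n => ⟨planeWave n, continuous_planeWave n⟩
  let A : StarSubalgebra ℂ C(Torus d L, ℂ) :=
    { toSubalgebra := Algebra.adjoin ℂ (Set.range e)
      star_mem' := by
        change Algebra.adjoin ℂ (Set.range e) ≤ star (Algebra.adjoin ℂ (Set.range e))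
        refine Algebra.adjoin_le ?_
        rintro _ ⟨n, rfl⟩
        refine Algebra.subset_adjoin ⟨-n, ?_⟩
        ext1 x
        exact planeWave_neg n x }
  -- Plane waves are closed under products, so the algebra they generate is their linear span and
  -- its elements are trigonometric polynomials.
  have hspan : A.toSubalgebra.toSubmodule = Submodule.span ℂ (Set.range e) := by
    apply Algebra.adjoin_eq_span_of_subset
    refine .trans (fun x ↦ Submonoid.closure_induction (fun _ ↦ id) ⟨0, ?_⟩ ?_)
      Submodule.subset_span
    · ext z
      exact planeWave_zero z
    · rintro _ _ _ _ ⟨m, rfl⟩ ⟨n, rfl⟩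
      refine ⟨m + n, ?_⟩
      ext z
      exact planeWave_add m n z
  have hsep : A.SeparatesPoints := by
    intro x y hxy
    obtain ⟨i, hi⟩ := Function.ne_iff.mp hxy
    refine ⟨_, ⟨e (Pi.single i 1), Algebra.subset_adjoin ⟨Pi.single i 1, rfl⟩, rfl⟩, ?_⟩
    have key : ∀ z : Torus d L, planeWave (Pi.single i 1) z = fourier 1 (z i) := fun z => by
      unfold planeWave
      rw [Finset.prod_eq_single i]
      · simp
      · intro j _ hj
        simp [Pi.single_eq_of_ne hj]
      · simp
    change planeWave _ x ≠ planeWave _ y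
    rw [key, key, fourier_one, fourier_one]
    intro h
    exact hi (AddCircle.injective_toCircle (Fact.out : 0 < L).ne' (Circle.coe_injective h))
  have htop := ContinuousMap.starSubalgebra_topologicalClosure_eq_top_of_separatesPoints A hsep
  have hg : g ∈ closure (A : Set C(Torus d L, ℂ)) := by
    rw [← StarSubalgebra.topologicalClosure_coe, htop]
    trivial
  obtain ⟨p, hp, hgp⟩ := Metric.mem_closure_iff.mp hg ε hε
  have hp' : p ∈ Submodule.span ℂ (Set.range e) := by
    rw [← hspan]
    exact hp
  obtain ⟨c, rfl⟩ := Finsupp.mem_span_range_iff_exists_finsupp.mp hp'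
  refine ⟨c, fun x => ?_⟩
  have h1 := (ContinuousMap.dist_apply_le_dist (f := g) (g := c.sum fun i a => a • e i) x).trans hgp.le
  rw [dist_eq_norm] at h1
  have h2 : trigPoly c x = (c.sum fun i a => a • e i) x := by
    simp [trigPoly, Finsupp.sum, ContinuousMap.sum_apply, e]
  rw [h2]
  exact h1

lemma exists_trigPoly_integral_le {V : Torus d L → ℝ} (hV : Integrable V volume)
    {ε : ℝ} (hε : 0 < ε) :
    ∃ c : (Fin d → ℤ) →₀ ℂ, ∫ x, ‖(V x : ℂ) - trigPoly c x‖ ≤ ε := by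
  have hL : (0 : ℝ) < L := Fact.out
  have hLd : 0 < L ^ d := pow_pos hL d
  obtain ⟨g, hg, hgi⟩ := hV.complexOfReal.exists_boundedContinuous_integral_sub_le
    (half_pos hε)
  obtain ⟨c, hc⟩ := exists_trigPoly_uniform (g : C(Torus d L, ℂ))
    (show 0 < ε / 2 / L ^ d by positivity)
  refine ⟨c, ?_⟩
  have hgc : Integrable (fun x => ‖g x - trigPoly c x‖) volume :=
    (hgi.sub (integrable_trigPoly c)).norm
  have hVg : Integrable (fun x => ‖(V x : ℂ) - g x‖) volume := (hV.complexOfReal.sub hgi).norm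
  calc ∫ x, ‖(V x : ℂ) - trigPoly c x‖
      ≤ ∫ x, (‖(V x : ℂ) - g x‖ + ‖g x - trigPoly c x‖) := by
        refine integral_mono ((hV.complexOfReal.sub (integrable_trigPoly c)).norm) (hVg.add hgc) fun x => ?_
        exact norm_sub_le_norm_sub_add_norm_sub _ _ _
    _ = (∫ x, ‖(V x : ℂ) - g x‖) + ∫ x, ‖g x - trigPoly c x‖ := integral_add hVg hgc
    _ ≤ ε / 2 + ∫ _ : Torus d L, ε / 2 / L ^ d := by
        refine add_le_add hg (integral_mono hgc (integrable_const _) fun x => hc x)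
    _ = ε := by
        rw [integral_const, volume_real_univ, smul_eq_mul]
        field_simp
        ring

lemma integral_mul_conj_sum {ι : Type*} (s : Finset ι) (n : ι → Fin d → ℤ) (c : ι → ℂ)
    {h : Torus d L → ℂ} (hh : Integrable h volume) :
    ∫ x, h x * ∑ i ∈ s, c i * conj (planeWave (n i) x) =
      ∑ i ∈ s, c i * ∫ x, h x * conj (planeWave (n i) x) := by
  conv_lhs => enter [2, x]; rw [Finset.mul_sum]
  rw [integral_finsetSum]
  · refine Finset.sum_congr rfl fun i _ => ?_
    rw [← integral_const_mul]
    congr 1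
    ext x
    ring
  · intro i _
    refine hh.mul_bdd (c := ‖c i‖)
      (continuous_const.mul (Complex.continuous_conj.comp (continuous_planeWave _))).aestronglyMeasurable
      (Filter.Eventually.of_forall fun x => ?_)
    simp [norm_planeWave]

lemma integral_trigPoly_mul_conj (c : (Fin d → ℤ) →₀ ℂ) (n : Fin d → ℤ) :
    ∫ x : Torus d L, trigPoly c x * conj (planeWave n x) = c n * (L : ℂ) ^ d := by
  classical
  unfold trigPoly Finsupp.sum
  simp_rw [Finset.sum_mul, mul_assoc]
  rw [integral_finsetSum]
  · simp_rw [integral_const_mul, integral_planeWave_mul_conj]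
    simp +contextual
  · intro m _
    simp_rw [← planeWave_neg, ← planeWave_add]
    exact (integrable_planeWave _).const_mul _

lemma fourierTransform_eq (V : Torus d L → ℝ) (n : Fin d → ℤ) :
    fourierTransform V n = ∫ x, (V x : ℂ) * conj (planeWave n x) := by
  simp_rw [fourierTransform, planeWave_neg]

lemma integrable_mul_conj_planeWave {f : Torus d L → ℂ} (hf : Integrable f volume)
    (n : Fin d → ℤ) : Integrable (fun x => f x * conj (planeWave n x)) volume :=
  hf.mul_bdd (c := 1)
    (Complex.continuous_conj.comp (continuous_planeWave _)).aestronglyMeasurable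
    (Filter.Eventually.of_forall fun x => by simp [norm_planeWave])

/-- One approximation in `L¹` controls all Fourier coefficients uniformly; outside the support of
`c` it bounds the coefficient of `V` itself. -/
lemma norm_fourierTransform_sub_le {V : Torus d L → ℝ} (hV : Integrable V volume)
    (c : (Fin d → ℤ) →₀ ℂ) (n : Fin d → ℤ) :
    ‖fourierTransform V n - c n * (L : ℂ) ^ d‖ ≤ ∫ x, ‖(V x : ℂ) - trigPoly c x‖ := by
  rw [fourierTransform_eq, ← integral_trigPoly_mul_conj, ← integral_sub
    (integrable_mul_conj_planeWave hV.complexOfReal n)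
    (integrable_mul_conj_planeWave (integrable_trigPoly c) n)]
  refine (norm_integral_le_integral_norm _).trans (le_of_eq ?_)
  congr 1
  ext x
  rw [← sub_mul, norm_mul, RCLike.norm_conj, norm_planeWave, mul_one]

lemma norm_fourierTransform_le (h : Torus d L → ℝ) (n : Fin d → ℤ) :
    ‖fourierTransform h n‖ ≤ ∫ x, |h x| := by
  rw [fourierTransform_eq]
  refine (norm_integral_le_integral_norm _).trans (le_of_eq ?_)
  congr 1
  ext x
  rw [norm_mul, RCLike.norm_conj, norm_planeWave, mul_one, Complex.norm_real, Real.norm_eq_abs]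

lemma fourierTransform_zero (h : Torus d L → ℝ) :
    fourierTransform h 0 = ((∫ x, h x : ℝ) : ℂ) := by
  simp_rw [fourierTransform, neg_zero, planeWave_zero, mul_one]
  exact integral_ofReal

lemma fourierTransform_sub {f g : Torus d L → ℝ} (hf : Integrable f volume)
    (hg : Integrable g volume) (n : Fin d → ℤ) :
    fourierTransform (fun x => f x - g x) n = fourierTransform f n - fourierTransform g n := by
  simp_rw [fourierTransform_eq]
  rw [← integral_sub (integrable_mul_conj_planeWave hf.complexOfReal n)
    (integrable_mul_conj_planeWave hg.complexOfReal n)]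
  simp_rw [Complex.ofReal_sub, sub_mul]

/-- Riemann–Lebesgue: there are only finitely many wave vectors at which the Fourier transform is
not small. -/
lemma finite_setOf_le_norm_fourierTransform {V : Torus d L → ℝ} (hV : Integrable V volume)
    {ε : ℝ} (hε : 0 < ε) : {n | ε ≤ ‖fourierTransform V n‖}.Finite := by
  obtain ⟨c, hc⟩ := exists_trigPoly_integral_le hV (half_pos hε)
  refine c.support.finite_toSet.subset fun n hn => ?_
  by_contra h0
  have h1 := (norm_fourierTransform_sub_le hV c n).trans hc
  rw [Finset.mem_coe, Finsupp.notMem_support_iff] at h0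
  rw [h0, zero_mul, sub_zero] at h1
  have h2 : ε ≤ ‖fourierTransform V n‖ := hn
  linarith

/-- Bessel's inequality. -/
lemma sum_normSq_fourierTransform_le {h : Torus d L → ℝ} (hh : Integrable h volume)
    (hh2 : Integrable (fun x => h x ^ 2) volume) (s : Finset (Fin d → ℤ)) :
    ∑ n ∈ s, ‖fourierTransform h n‖ ^ 2 ≤ L ^ d * ∫ x, h x ^ 2 := by
  classical
  have hL : (0 : ℝ) < L := Fact.out
  have hLd : 0 < L ^ d := pow_pos hL d
  -- The polynomial `p` with coefficients those of `h` on `s`, not normalized by the volume: pairing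
  -- it with `h` gives `S`, and its squared norm is `S * L ^ d`.
  let c : (Fin d → ℤ) →₀ ℂ := Finsupp.onFinset s
    (fun n => if n ∈ s then fourierTransform h n else 0) (fun n hn => by
      by_contra h'
      simp [h'] at hn)
  have hcs : ∀ f : (Fin d → ℤ) → ℂ → ℂ, (∀ n, f n 0 = 0) →
      c.sum f = ∑ n ∈ s, f n (fourierTransform h n) := by
    intro f hf
    rw [Finsupp.onFinset_sum _ (fun n => hf n)]
    exact Finset.sum_congr rfl fun n hn => by simp [hn]
  set S : ℝ := ∑ n ∈ s, ‖fourierTransform h n‖ ^ 2 with hS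
  have hp : ∀ x : Torus d L, conj (trigPoly c x) =
      ∑ n ∈ s, conj (fourierTransform h n) * conj (planeWave n x) := by
    intro x
    rw [trigPoly, hcs _ (by simp), map_sum]
    simp
  have h1 : ∫ x, (h x : ℂ) * conj (trigPoly c x) = S := by
    simp_rw [hp]
    rw [integral_mul_conj_sum s (fun n => n) (fun n => conj (fourierTransform h n)) hh.complexOfReal, hS,
      Complex.ofReal_sum]
    refine Finset.sum_congr rfl fun n _ => ?_
    rw [← fourierTransform_eq, mul_comm, Complex.mul_conj, Complex.normSq_eq_norm_sq]
  have h2 : ∫ x : Torus d L, trigPoly c x * conj (trigPoly c x) = (S * L ^ d : ℝ) := by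
    simp_rw [hp]
    rw [integral_mul_conj_sum s (fun n => n) (fun n => conj (fourierTransform h n))
      (integrable_trigPoly c), hS, Complex.ofReal_mul, Complex.ofReal_sum, Finset.sum_mul]
    refine Finset.sum_congr rfl fun n hn => ?_
    rw [integral_trigPoly_mul_conj]
    have : c n = fourierTransform h n := by simp [c, hn]
    rw [this, ← mul_assoc, mul_comm (conj _), Complex.mul_conj, Complex.normSq_eq_norm_sq]
    push_cast
    ring
  have hpint : Integrable (fun x : Torus d L => ‖trigPoly c x‖ ^ 2) volume :=
    ((continuous_trigPoly c).norm.pow 2).integrable_of_hasCompactSupport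
      (HasCompactSupport.of_compactSpace _)
  have h2' : ∫ x : Torus d L, ‖trigPoly c x‖ ^ 2 = S * L ^ d := by
    simp_rw [Complex.mul_conj, Complex.normSq_eq_norm_sq] at h2
    rw [integral_complex_ofReal] at h2
    exact_mod_cast h2
  -- Young's inequality, with weights for which the polynomial contributes exactly `S / 2`, to be
  -- absorbed on the left.
  have h3 : S ≤ ∫ x, (L ^ d / 2 * h x ^ 2 + (2 * L ^ d)⁻¹ * ‖trigPoly c x‖ ^ 2) := by
    have e1 : S = ‖∫ x, (h x : ℂ) * conj (trigPoly c x)‖ := by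
      rw [h1, Complex.norm_real, Real.norm_of_nonneg]
      exact Finset.sum_nonneg fun n _ => by positivity
    rw [e1]
    refine norm_integral_le_of_norm_le ((hh2.const_mul _).add (hpint.const_mul _))
      (Filter.Eventually.of_forall fun x => ?_)
    rw [norm_mul, RCLike.norm_conj, Complex.norm_real, Real.norm_eq_abs, ← sq_abs (h x)]
    set A := |h x|
    set B := ‖trigPoly c x‖
    have := sq_nonneg (L ^ d * A - B)
    field_simp
    nlinarith
  rw [integral_add (hh2.const_mul _) (hpint.const_mul _), integral_const_mul, integral_const_mul,
    h2'] at h3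
  have h4 : (2 * L ^ d)⁻¹ * (S * L ^ d) = S / 2 := by
    field_simp
  rw [h4] at h3
  linarith

end

end McKeanVlasov

/-! ### The interaction energy and its Fourier representation -/

namespace McKeanVlasov

noncomputable section

open scoped ComplexConjugate
open Filter Topology

variable {d : ℕ} {L : ℝ} [Fact (0 < L)]

lemma measurePreserving_sub_snd :
    MeasurePreserving (fun p : Torus d L × Torus d L => (p.1 - p.2, p.2)) volume volume :=
  measurePreserving_sub_prod volume volume

lemma measurePreserving_sub_fst :
    MeasurePreserving (fun p : Torus d L × Torus d L => (p.1 - p.2, p.1)) volume volume := by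
  have h1 : MeasurePreserving (fun p : Torus d L × Torus d L => (-p.1, p.2)) volume volume :=
    (Measure.measurePreserving_neg (volume : Measure (Torus d L))).prod (MeasurePreserving.id _)
  have h2 : MeasurePreserving (Prod.swap : Torus d L × Torus d L → _) volume volume :=
    Measure.measurePreserving_swap
  have h3 := h1.comp (measurePreserving_sub_snd.comp h2)
  convert h3 using 1
  ext p <;> simp

lemma integrable_sub_mul_snd {𝕜 : Type*} [RCLike 𝕜] {F G : Torus d L → 𝕜}
    (hF : Integrable F volume) (hG : Integrable G volume) :
    Integrable (fun p : Torus d L × Torus d L => F (p.1 - p.2) * G p.2) volume :=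
  (measurePreserving_sub_snd.integrable_comp_of_integrable (hF.mul_prod hG) :)

lemma integrable_sub_mul_fst {𝕜 : Type*} [RCLike 𝕜] {F G : Torus d L → 𝕜}
    (hF : Integrable F volume) (hG : Integrable G volume) :
    Integrable (fun p : Torus d L × Torus d L => F (p.1 - p.2) * G p.1) volume :=
  (measurePreserving_sub_fst.integrable_comp_of_integrable (hF.mul_prod hG) :)

lemma integral_comp_measurePreserving {α β E : Type*} [MeasurableSpace α] [MeasurableSpace β]
    [NormedAddCommGroup E] [NormedSpace ℝ E] {μ : Measure α} {ν : Measure β} {T : α → β}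
    (hT : MeasurePreserving T μ ν) {F : β → E} (hF : Integrable F ν) :
    ∫ x, F (T x) ∂μ = ∫ y, F y ∂ν := by
  have h := hT.map_eq
  rw [← h, integral_map hT.measurable.aemeasurable]
  rw [h]
  exact hF.1

lemma integral_sub_mul_snd {𝕜 : Type*} [RCLike 𝕜] {F G : Torus d L → 𝕜}
    (hF : Integrable F volume) (hG : Integrable G volume) :
    ∫ p : Torus d L × Torus d L, F (p.1 - p.2) * G p.2 = (∫ x, F x) * ∫ x, G x := by
  rw [← integral_prod_mul]
  exact integral_comp_measurePreserving measurePreserving_sub_snd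
    (F := fun p : Torus d L × Torus d L => F p.1 * G p.2) (hF.mul_prod hG)

lemma integral_sub_mul_fst {𝕜 : Type*} [RCLike 𝕜] {F G : Torus d L → 𝕜}
    (hF : Integrable F volume) (hG : Integrable G volume) :
    ∫ p : Torus d L × Torus d L, F (p.1 - p.2) * G p.1 = (∫ x, F x) * ∫ x, G x := by
  rw [← integral_prod_mul]
  exact integral_comp_measurePreserving measurePreserving_sub_fst
    (F := fun p : Torus d L × Torus d L => F p.1 * G p.2) (hF.mul_prod hG)

lemma quasiMeasurePreserving_sub : Measure.QuasiMeasurePreserving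
    (fun p : Torus d L × Torus d L => p.1 - p.2) volume volume :=
  Measure.quasiMeasurePreserving_fst.comp measurePreserving_sub_snd.quasiMeasurePreserving

lemma quasiMeasurePreserving_fst : Measure.QuasiMeasurePreserving
    (fun p : Torus d L × Torus d L => p.1) volume volume :=
  Measure.quasiMeasurePreserving_fst

lemma quasiMeasurePreserving_snd : Measure.QuasiMeasurePreserving
    (fun p : Torus d L × Torus d L => p.2) volume volume :=
  Measure.quasiMeasurePreserving_snd

lemma aestronglyMeasurable_energyDensity {V f g : Torus d L → ℝ}
    (hV : AEStronglyMeasurable V volume) (hf : AEStronglyMeasurable f volume)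
    (hg : AEStronglyMeasurable g volume) :
    AEStronglyMeasurable (energyDensity V f g) volume :=
  ((hV.comp_quasiMeasurePreserving quasiMeasurePreserving_sub).mul
    (hf.comp_quasiMeasurePreserving quasiMeasurePreserving_fst)).mul
    (hg.comp_quasiMeasurePreserving quasiMeasurePreserving_snd)

lemma energyDensity_ae_congr {V f f' g g' : Torus d L → ℝ} (hf : f =ᵐ[volume] f')
    (hg : g =ᵐ[volume] g') : energyDensity V f g =ᵐ[volume] energyDensity V f' g' := by
  filter_upwards [quasiMeasurePreserving_fst.ae_eq_comp hf,
    quasiMeasurePreserving_snd.ae_eq_comp hg] with p h1 h2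
  simp only [Function.comp] at h1 h2
  simp only [energyDensity, h1, h2]

/-- Since `V` is only integrable, the energy of two integrable functions may diverge; a bound on one
of them suffices for convergence. -/
lemma integrable_energyDensity_of_bdd_left {V f g : Torus d L → ℝ} {M : ℝ}
    (hV : Integrable V volume) (hf : AEStronglyMeasurable f volume)
    (hfM : ∀ᵐ x, |f x| ≤ M) (hg : Integrable g volume) :
    Integrable (energyDensity V f g) volume := by
  have h := (integrable_sub_mul_snd hV hg).mul_bdd (c := M)
    (hf.comp_quasiMeasurePreserving quasiMeasurePreserving_fst)
    (quasiMeasurePreserving_fst.ae hfM)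
  refine h.congr (Eventually.of_forall fun p => ?_)
  simp only [energyDensity, Function.comp]
  ring

lemma integrable_energyDensity_of_bdd_right {V f g : Torus d L → ℝ} {M : ℝ}
    (hV : Integrable V volume) (hf : Integrable f volume) (hg : AEStronglyMeasurable g volume)
    (hgM : ∀ᵐ x, |g x| ≤ M) :
    Integrable (energyDensity V f g) volume := by
  have h := (integrable_sub_mul_fst hV hf).mul_bdd (c := M)
    (hg.comp_quasiMeasurePreserving quasiMeasurePreserving_snd)
    (quasiMeasurePreserving_snd.ae hgM)
  exact h

lemma energy_const_left {V g : Torus d L → ℝ} (hV : Integrable V volume)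
    (hg : Integrable g volume) (c : ℝ) :
    energy V (fun _ => c) g = c * ((∫ x, V x) * ∫ x, g x) := by
  rw [← integral_sub_mul_snd hV hg, ← integral_const_mul]
  unfold energy energyDensity
  congr 1
  ext p
  ring

lemma energy_const_right {V f : Torus d L → ℝ} (hV : Integrable V volume)
    (hf : Integrable f volume) (c : ℝ) :
    energy V f (fun _ => c) = c * ((∫ x, V x) * ∫ x, f x) := by
  rw [← integral_sub_mul_fst hV hf, ← integral_const_mul]
  unfold energy energyDensity
  congr 1
  ext p
  ring

lemma energy_add_add {V f g : Torus d L → ℝ} (hff : Integrable (energyDensity V f f) volume)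
    (hfg : Integrable (energyDensity V f g) volume) (hgf : Integrable (energyDensity V g f) volume)
    (hgg : Integrable (energyDensity V g g) volume) :
    energy V (fun x => f x + g x) (fun x => f x + g x) =
      energy V f f + energy V f g + energy V g f + energy V g g := by
  have h1 := integral_add' ((hff.add hfg).add hgf) hgg
  rw [integral_add' (hff.add hfg) hgf, integral_add' hff hfg] at h1
  unfold energy
  rw [← h1]
  congr 1
  ext p
  simp only [energyDensity, Pi.add_apply]
  ring

/-- The expansion of the energy around a constant. -/
lemma energy_const_add {V h : Torus d L → ℝ} (hV : Integrable V volume) (hh : Integrable h volume)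
    (hhh : Integrable (energyDensity V h h) volume) (c : ℝ) :
    energy V (fun x => c + h x) (fun x => c + h x) =
      c * c * L ^ d * (∫ x, V x) + 2 * c * ((∫ x, V x) * ∫ x, h x) + energy V h h := by
  have hc : Integrable (fun _ : Torus d L => c) volume := integrable_const c
  have hb : ∀ᵐ _ : Torus d L, |c| ≤ |c| := Eventually.of_forall fun _ => le_rfl
  rw [energy_add_add (f := fun _ => c) (integrable_energyDensity_of_bdd_left hV hc.1 hb hc)
    (integrable_energyDensity_of_bdd_left hV hc.1 hb hh)
    (integrable_energyDensity_of_bdd_right hV hh hc.1 hb) hhh, energy_const_left hV hc,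
    energy_const_left hV hh, energy_const_right hV hh, integral_const, volume_real_univ,
    smul_eq_mul]
  ring

/-- A character of `x - y` splits into a function of `x` times a function of `y`, so the double
integral is a Fourier coefficient times its conjugate. -/
lemma integral_planeWave_kernel (h : Torus d L → ℝ) (n : Fin d → ℤ) :
    ∫ p : Torus d L × Torus d L, planeWave n (p.1 - p.2) * ((h p.1 * h p.2 : ℝ) : ℂ) =
      ((‖fourierTransform h n‖ ^ 2 : ℝ) : ℂ) := by
  have h1 : ∀ p : Torus d L × Torus d L, planeWave n (p.1 - p.2) * ((h p.1 * h p.2 : ℝ) : ℂ) =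
      (h p.1 * planeWave n p.1) * (h p.2 * conj (planeWave n p.2)) := fun p => by
    rw [planeWave_apply_sub]
    push_cast
    ring
  simp_rw [h1]
  have h2 := integral_prod_mul (μ := (volume : Measure (Torus d L)))
    (ν := (volume : Measure (Torus d L))) (fun x => (h x : ℂ) * planeWave n x)
    (fun x => (h x : ℂ) * conj (planeWave n x))
  refine h2.trans ?_
  have h3 : ∫ x, (h x : ℂ) * planeWave n x = conj (∫ x, (h x : ℂ) * conj (planeWave n x)) := by
    rw [← integral_conj]
    simp
  rw [h3, ← fourierTransform_eq, mul_comm, Complex.mul_conj, Complex.normSq_eq_norm_sq]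

lemma integrable_kernel {P : Torus d L → ℂ} {h : Torus d L → ℝ} {M : ℝ}
    (hP : Integrable P volume) (hh : Integrable h volume) (hM : ∀ᵐ x, |h x| ≤ M) :
    Integrable (fun p : Torus d L × Torus d L => P (p.1 - p.2) * ((h p.1 * h p.2 : ℝ) : ℂ))
      volume := by
  have h1 := (integrable_sub_mul_fst hP hh.complexOfReal).mul_bdd (c := M)
    (hh.complexOfReal.1.comp_quasiMeasurePreserving quasiMeasurePreserving_snd)
    (by
      filter_upwards [quasiMeasurePreserving_snd.ae hM] with p hp
      simpa using hp)
  refine h1.congr (Eventually.of_forall fun p => ?_)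
  simp [mul_assoc]

lemma integral_trigPoly_kernel {h : Torus d L → ℝ} {M : ℝ} (hh : Integrable h volume)
    (hM : ∀ᵐ x, |h x| ≤ M) (c : (Fin d → ℤ) →₀ ℂ) :
    ∫ p : Torus d L × Torus d L, trigPoly c (p.1 - p.2) * ((h p.1 * h p.2 : ℝ) : ℂ) =
      ∑ n ∈ c.support, c n * ((‖fourierTransform h n‖ ^ 2 : ℝ) : ℂ) := by
  unfold trigPoly Finsupp.sum
  simp_rw [Finset.sum_mul, mul_assoc]
  rw [integral_finsetSum]
  · simp_rw [integral_const_mul, integral_planeWave_kernel]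
  · intro n _
    exact (integrable_kernel (integrable_planeWave n) hh hM).const_mul _

/-- The energy of a bounded function is approximated by that for a trigonometric polynomial. -/
lemma abs_energy_sub_sum_le {V h : Torus d L → ℝ} {M : ℝ} (hV : Integrable V volume)
    (hh : Integrable h volume) (hM : ∀ᵐ x, |h x| ≤ M) (c : (Fin d → ℤ) →₀ ℂ) :
    |energy V h h - ∑ n ∈ c.support, (c n).re * ‖fourierTransform h n‖ ^ 2| ≤
      M * ((∫ x, ‖(V x : ℂ) - trigPoly c x‖) * ∫ x, |h x|) := by
  have hD : Integrable (fun x => (V x : ℂ) - trigPoly c x) volume :=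
    hV.complexOfReal.sub (integrable_trigPoly c)
  have e1 : ((energy V h h : ℝ) : ℂ) =
      ∫ p : Torus d L × Torus d L, (V (p.1 - p.2) : ℂ) * ((h p.1 * h p.2 : ℝ) : ℂ) := by
    unfold energy
    rw [← integral_complex_ofReal]
    congr 1
    ext p
    simp [energyDensity, mul_assoc]
  have e2 := integral_sub (integrable_kernel hV.complexOfReal hh hM)
    (integrable_kernel (integrable_trigPoly c) hh hM)
  rw [← e1, integral_trigPoly_kernel hh hM] at e2
  have e3 : |energy V h h - ∑ n ∈ c.support, (c n).re * ‖fourierTransform h n‖ ^ 2| ≤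
      ‖((energy V h h : ℝ) : ℂ) -
        ∑ n ∈ c.support, c n * ((‖fourierTransform h n‖ ^ 2 : ℝ) : ℂ)‖ := by
    refine le_trans (le_of_eq ?_) (Complex.abs_re_le_norm _)
    rw [Complex.sub_re, Complex.ofReal_re, Complex.re_sum]
    simp_rw [Complex.re_mul_ofReal]
  refine e3.trans ?_
  rw [← e2, ← integral_sub_mul_fst hD.norm hh.abs, ← integral_const_mul]
  refine norm_integral_le_of_norm_le ((integrable_sub_mul_fst hD.norm hh.abs).const_mul M) ?_
  filter_upwards [quasiMeasurePreserving_snd.ae hM] with p hp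
  rw [← sub_mul, norm_mul, Complex.norm_real, Real.norm_eq_abs, abs_mul]
  have h1 : 0 ≤ ‖(V (p.1 - p.2) : ℂ) - trigPoly c (p.1 - p.2)‖ * |h p.1| := by positivity
  nlinarith

lemma integrable_sq_of_bdd {h : Torus d L → ℝ} {M : ℝ} (hh : Integrable h volume)
    (hM : ∀ᵐ x, |h x| ≤ M) : Integrable (fun x => h x ^ 2) volume := by
  simp_rw [pow_two]
  exact hh.mul_bdd (c := M) hh.1 hM

/-- Replace `V` by a trigonometric polynomial. Its coefficients are almost nonnegative off zero, the
zero mode drops out because `h` has mean zero, and Bessel's inequality bounds the loss. -/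
lemma energy_nonneg_of_bdd {V h : Torus d L → ℝ} {M : ℝ} (hV : Integrable V volume)
    (hVn : ∀ n : Fin d → ℤ, n ≠ 0 → 0 ≤ fourierReal V n) (hh : Integrable h volume)
    (hM : ∀ᵐ x, |h x| ≤ M) (h0 : ∫ x, h x = 0) : 0 ≤ energy V h h := by
  have hL : (0 : ℝ) < L := Fact.out
  have hLd : 0 < L ^ d := pow_pos hL d
  have hh2 := integrable_sq_of_bdd hh hM
  have hM0 : 0 ≤ M := by
    obtain ⟨x, hx⟩ := hM.exists
    exact (abs_nonneg _).trans hx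
  -- The total error is `δ * K`: the first term comes from replacing `V`, the second from the
  -- slightly negative coefficients.
  set K : ℝ := M * (∫ x, |h x|) + ∫ x, h x ^ 2 with hK
  have hK0 : 0 ≤ K := by positivity
  refine le_of_forall_pos_le_add fun ε hε => ?_
  set δ : ℝ := ε / (K + 1) with hδ
  have hδ0 : 0 < δ := by positivity
  obtain ⟨c, hc⟩ := exists_trigPoly_integral_le hV hδ0
  have h1 := abs_energy_sub_sum_le hV hh hM c
  have h2 : -(δ / L ^ d) * ∑ n ∈ c.support, ‖fourierTransform h n‖ ^ 2 ≤
      ∑ n ∈ c.support, (c n).re * ‖fourierTransform h n‖ ^ 2 := by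
    rw [Finset.mul_sum]
    refine Finset.sum_le_sum fun n _ => ?_
    by_cases hn : n = 0
    · subst hn
      simp [fourierTransform_zero, h0]
    refine mul_le_mul_of_nonneg_right ?_ (by positivity)
    have h3 := (Complex.abs_re_le_norm _).trans ((norm_fourierTransform_sub_le hV c n).trans hc)
    have h4 : (c n * (L : ℂ) ^ d).re = (c n).re * L ^ d := by
      rw [← Complex.ofReal_pow, Complex.re_mul_ofReal]
    rw [Complex.sub_re, h4] at h3
    have h5 := hVn n hn
    unfold fourierReal at h5
    have h6 := (abs_le.mp h3).2
    rw [← neg_div, div_le_iff₀ hLd]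
    linarith
  have h7 := sum_normSq_fourierTransform_le hh hh2 c.support
  have h8 : -(δ / L ^ d) * (L ^ d * ∫ x, h x ^ 2) ≤
      -(δ / L ^ d) * ∑ n ∈ c.support, ‖fourierTransform h n‖ ^ 2 :=
    mul_le_mul_of_nonpos_left h7 (by rw [neg_nonpos]; positivity)
  have h9 : -(δ / L ^ d) * (L ^ d * ∫ x, h x ^ 2) = -(δ * ∫ x, h x ^ 2) := by
    field_simp
  have h10 : M * ((∫ x, ‖(V x : ℂ) - trigPoly c x‖) * ∫ x, |h x|) ≤ M * (δ * ∫ x, |h x|) := by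
    gcongr
  have h11 : δ * K ≤ ε := by
    rw [hδ, div_mul_eq_mul_div, div_le_iff₀ (by positivity)]
    nlinarith
  have h12 := (abs_le.mp h1).1
  rw [hK] at h11
  nlinarith

/-- A function whose Fourier transform is nonnegative at the nonzero wave vectors is of positive
type. -/
lemma isPositiveType_of_fourierReal_nonneg {V : Torus d L → ℝ} (hV : Integrable V volume)
    (hVn : ∀ n : Fin d → ℤ, n ≠ 0 → 0 ≤ fourierReal V n) : IsPositiveType V := by
  intro h hh h0 hE
  have hL : (0 : ℝ) < L := Fact.out
  have hLd : 0 < L ^ d := pow_pos hL d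
  -- Truncation replaces large values by zero. It never increases absolute values, so the energy
  -- density of `h` dominates those of the truncations.
  let t : ℕ → ℝ → ℝ := fun N y => if |y| ≤ N then y else 0
  have ht_meas : ∀ N, Measurable (t N) := fun N =>
    Measurable.ite (measurableSet_le measurable_abs measurable_const) measurable_id measurable_const
  have ht_le : ∀ N y, |t N y| ≤ |y| := fun N y => by
    simp only [t]
    split_ifs <;> simp
  have ht_bdd : ∀ N y, |t N y| ≤ N := fun N y => by
    simp only [t]
    split_ifs with h
    · exact h
    · simp
  have ht_lim : ∀ y, Tendsto (fun N => t N y) atTop (𝓝 y) := fun y => by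
    obtain ⟨N, hN⟩ := exists_nat_ge |y|
    refine tendsto_const_nhds.congr' ?_
    filter_upwards [eventually_ge_atTop N] with m hm
    simp only [t]
    rw [if_pos]
    exact hN.trans (by exact_mod_cast hm)
  let f : ℕ → Torus d L → ℝ := fun N x => t N (h x)
  have hf_meas : ∀ N, AEStronglyMeasurable (f N) volume := fun N =>
    ((ht_meas N).comp_aemeasurable hh.1.aemeasurable).aestronglyMeasurable
  have hf_int : ∀ N, Integrable (f N) volume := fun N =>
    hh.mono (hf_meas N) (Eventually.of_forall fun x => ht_le N (h x))
  have hf_bdd : ∀ N, ∀ᵐ x, |f N x| ≤ N := fun N => Eventually.of_forall fun x => ht_bdd N (h x)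
  have hm_lim : Tendsto (fun N => ∫ x, f N x) atTop (𝓝 0) := by
    rw [← h0]
    exact tendsto_integral_of_dominated_convergence (fun x => |h x|) hf_meas hh.abs
      (fun N => Eventually.of_forall fun x => ht_le N (h x))
      (Eventually.of_forall fun x => ht_lim (h x))
  have hE_lim : Tendsto (fun N => energy V (f N) (f N)) atTop (𝓝 (energy V h h)) := by
    refine tendsto_integral_of_dominated_convergence (fun p => |energyDensity V h h p|)
      (fun N => aestronglyMeasurable_energyDensity hV.1 (hf_meas N) (hf_meas N)) hE.abs
      (fun N => Eventually.of_forall fun p => ?_) (Eventually.of_forall fun p => ?_)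
    · simp only [energyDensity, Real.norm_eq_abs, abs_mul]
      have h1 := ht_le N (h p.1)
      have h2 := ht_le N (h p.2)
      gcongr
    · exact (tendsto_const_nhds.mul (ht_lim (h p.1))).mul (ht_lim (h p.2))
  -- Truncation destroys mean zero. Subtracting the mean restores it, and expanding around the
  -- constant gives a correction that vanishes in the limit.
  have key : ∀ N, 0 ≤ energy V (f N) (f N) - (∫ x, V x) * (∫ x, f N x) ^ 2 / L ^ d := by
    intro N
    set m := ∫ x, f N x with hm
    have h1 : Integrable (fun x => -(m / L ^ d) + f N x) volume :=
      (integrable_const _).add (hf_int N)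
    have h2 := energy_nonneg_of_bdd (M := |m / L ^ d| + N) hV hVn h1 (by
      filter_upwards [hf_bdd N] with x hx
      refine (abs_add_le _ _).trans ?_
      rw [abs_neg]
      gcongr) (by
      rw [integral_add (integrable_const _) (hf_int N), integral_const, volume_real_univ,
        smul_eq_mul, ← hm]
      field_simp
      ring)
    rw [energy_const_add hV (hf_int N) (integrable_energyDensity_of_bdd_left hV (hf_meas N)
      (hf_bdd N) (hf_int N)), ← hm] at h2
    convert h2 using 1
    field_simp
    ring
  refine ge_of_tendsto' (x := atTop) (f := fun N => energy V (f N) (f N) -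
    (∫ x, V x) * (∫ x, f N x) ^ 2 / L ^ d) ?_ key
  convert hE_lim.sub ((hm_lim.pow 2).const_mul (∫ x, V x) |>.div_const (L ^ d)) using 2
  simp

/-- By Riemann–Lebesgue only finitely many coefficients lie at or below a given negative value, so
the minimum is over a finite set. -/
lemma exists_isMinimizingWaveVector {V : Torus d L → ℝ} (hV : Integrable V volume)
    {m : Fin d → ℤ} (hm : m ≠ 0) (hVm : fourierReal V m < 0) :
    ∃ n : Fin d → ℤ, IsMinimizingWaveVector V n := by
  have hfin : {n : Fin d → ℤ | n ≠ 0 ∧ fourierReal V n ≤ fourierReal V m}.Finite := by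
    refine (finite_setOf_le_norm_fourierTransform hV (neg_pos.mpr hVm)).subset fun n hn => ?_
    have h1 := hn.2
    have h2 := Complex.abs_re_le_norm (fourierTransform V n)
    have h3 := neg_le_abs (fourierTransform V n).re
    simp only [Set.mem_ofPred_eq]
    unfold fourierReal at *
    linarith
  obtain ⟨n, hn, hmin⟩ := Set.exists_min_image _ (fourierReal V) hfin ⟨m, hm, le_rfl⟩
  refine ⟨n, hn.1, fun k hk => ?_⟩
  by_cases h : fourierReal V k ≤ fourierReal V m
  · exact hmin k ⟨hk, h⟩
  · exact hn.2.trans (not_le.mp h).le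

lemma exists_fourierReal_neg {V : Torus d L → ℝ} (hV : Integrable V volume)
    (hVn : ¬ IsPositiveType V) : ∃ m : Fin d → ℤ, m ≠ 0 ∧ fourierReal V m < 0 := by
  by_contra! h
  exact hVn (isPositiveType_of_fourierReal_nonneg hV h)

/-- The energy of differences tends to zero along a bounded sequence with convergent Fourier
transforms. -/
lemma eventually_abs_energy_sub_le {V : Torus d L → ℝ} (hV : Integrable V volume)
    {ρ : ℕ → Torus d L → ℝ} {M : ℝ} (hρ : ∀ j, Integrable (ρ j) volume)
    (hM : ∀ j x, |ρ j x| ≤ M) {ℓ : (Fin d → ℤ) → ℂ}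
    (hlim : ∀ n, Tendsto (fun j => fourierTransform (ρ j) n) atTop (𝓝 (ℓ n)))
    {ε : ℝ} (hε : 0 < ε) :
    ∀ᶠ q : ℕ × ℕ in atTop, |energy V (fun x => ρ q.1 x - ρ q.2 x)
      (fun x => ρ q.1 x - ρ q.2 x)| ≤ ε := by
  have hL : (0 : ℝ) < L := Fact.out
  have hLd : 0 < L ^ d := pow_pos hL d
  have hM0 : 0 ≤ M := (abs_nonneg _).trans (hM 0 0)
  -- The product of the sup bound and the `L¹` bound for a difference, as they enter
  -- `abs_energy_sub_sum_le`.
  set K : ℝ := 2 * M * (2 * M * L ^ d) with hK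
  have hK0 : 0 ≤ K := by positivity
  obtain ⟨c, hc⟩ := exists_trigPoly_integral_le hV (show 0 < ε / 2 / (K + 1) by positivity)
  have h1 : Tendsto (fun q : ℕ × ℕ => ∑ n ∈ c.support, (c n).re *
      ‖fourierTransform (fun x => ρ q.1 x - ρ q.2 x) n‖ ^ 2) atTop (𝓝 0) := by
    have h2 : Tendsto (fun q : ℕ × ℕ => ∑ n ∈ c.support, (c n).re *
        ‖fourierTransform (ρ q.1) n - fourierTransform (ρ q.2) n‖ ^ 2) atTop
        (𝓝 (∑ n ∈ c.support, (c n).re * ‖ℓ n - ℓ n‖ ^ 2)) := by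
      refine tendsto_finsetSum _ fun n _ => (((Tendsto.sub ?_ ?_).norm).pow 2).const_mul _
      · rw [← prod_atTop_atTop_eq]
        exact (hlim n).comp tendsto_fst
      · rw [← prod_atTop_atTop_eq]
        exact (hlim n).comp tendsto_snd
    simpa [fourierTransform_sub (hρ _) (hρ _)] using h2
  filter_upwards [h1.eventually (Metric.ball_mem_nhds 0 (half_pos hε))] with q hq
  replace hq := mem_ball_zero_iff.mp hq
  rw [Real.norm_eq_abs] at hq
  have hdiff : Integrable (fun x => ρ q.1 x - ρ q.2 x) volume := (hρ _).sub (hρ _)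
  have hbd : ∀ x, |ρ q.1 x - ρ q.2 x| ≤ 2 * M := fun x => by
    refine (abs_sub _ _).trans ?_
    linarith [hM q.1 x, hM q.2 x]
  have h3 := abs_energy_sub_sum_le hV hdiff (Eventually.of_forall hbd) c
  have h4 : ∫ x, |ρ q.1 x - ρ q.2 x| ≤ 2 * M * L ^ d := by
    refine (integral_mono hdiff.abs (integrable_const (2 * M)) hbd).trans (le_of_eq ?_)
    rw [integral_const, volume_real_univ, smul_eq_mul, mul_comm]
  have h5 : 2 * M * ((∫ x, ‖(V x : ℂ) - trigPoly c x‖) * ∫ x, |ρ q.1 x - ρ q.2 x|) ≤ ε / 2 := by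
    calc _ ≤ 2 * M * (ε / 2 / (K + 1) * (2 * M * L ^ d)) := by gcongr
      _ = ε / 2 * (K / (K + 1)) := by rw [hK]; ring
      _ ≤ ε / 2 * 1 := by
        gcongr
        rw [div_le_one (by positivity)]
        linarith
      _ = ε / 2 := mul_one _
  have h6 := abs_sub_abs_le_abs_sub (energy V (fun x => ρ q.1 x - ρ q.2 x)
    (fun x => ρ q.1 x - ρ q.2 x)) (∑ n ∈ c.support, (c n).re *
      ‖fourierTransform (fun x => ρ q.1 x - ρ q.2 x) n‖ ^ 2)
  linarith

lemma integral_planeWave_re_sq {n : Fin d → ℤ} (hn : n ≠ 0) :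
    ∫ x : Torus d L, (planeWave n x).re ^ 2 = L ^ d / 2 := by
  have h2n : n + n ≠ 0 := by
    rw [← two_nsmul]
    exact smul_ne_zero two_ne_zero hn
  have h1 : ∀ x : Torus d L, (planeWave n x).re ^ 2 = 1 / 2 + (planeWave (n + n) x).re / 2 := by
    intro x
    have h := norm_planeWave n x
    have h' : (planeWave n x).re ^ 2 + (planeWave n x).im ^ 2 = 1 := by
      rw [← Complex.sq_norm_sub_sq_re, h]
      ring
    rw [planeWave_add, Complex.mul_re]
    nlinarith
  have h3 : ∫ x : Torus d L, (planeWave (n + n) x).re = 0 := by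
    rw [← Complex.zero_re, ← integral_planeWave (L := L) h2n]
    exact integral_re (integrable_planeWave _)
  have h4 : Integrable (fun x : Torus d L => (planeWave (n + n) x).re / 2) volume :=
    (integrable_planeWave (n + n)).re.div_const 2
  simp_rw [h1]
  rw [integral_add (integrable_const _) h4,
    integral_const, integral_div, h3, volume_real_univ, smul_eq_mul]
  ring

lemma integral_planeWave_re {n : Fin d → ℤ} (hn : n ≠ 0) :
    ∫ x : Torus d L, (planeWave n x).re = 0 := by
  rw [← Complex.zero_re, ← integral_planeWave (L := L) hn]
  exact integral_re (integrable_planeWave _)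

/-- The energy of the real part of a plane wave. -/
lemma energy_planeWave_re {V : Torus d L → ℝ} (hV : Integrable V volume) {n : Fin d → ℤ}
    (hn : n ≠ 0) :
    energy V (fun x => (planeWave n x).re) (fun x => (planeWave n x).re) =
      L ^ d / 2 * fourierReal V n := by
  have h2n : n + n ≠ 0 := by
    rw [← two_nsmul]
    exact smul_ne_zero two_ne_zero hn
  have hVp : Integrable (fun x => (V x : ℂ) * planeWave n x) volume :=
    hV.complexOfReal.mul_bdd (c := 1) (continuous_planeWave n).aestronglyMeasurable
      (Eventually.of_forall fun x => (norm_planeWave n x).le)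
  -- Product-to-sum formula, arranged so that each term is a function of `x - y` times a function of
  -- `y`; the term carrying frequency `n + n` integrates to zero.
  have h1 : ∀ p : Torus d L × Torus d L,
      energyDensity V (fun x => (planeWave n x).re) (fun x => (planeWave n x).re) p =
      ((1 / 2 : ℂ) * (((V (p.1 - p.2) : ℂ) * planeWave n (p.1 - p.2)) * 1 +
        ((V (p.1 - p.2) : ℂ) * planeWave n (p.1 - p.2)) * planeWave (n + n) p.2)).re := by
    intro p
    have e1 : planeWave n (p.1 - p.2) * planeWave (n + n) p.2 =
        planeWave n p.1 * planeWave n p.2 := by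
      rw [planeWave_apply_sub, planeWave_add]
      have : conj (planeWave n p.2) * planeWave n p.2 = 1 := by
        rw [mul_comm, Complex.mul_conj, Complex.normSq_eq_norm_sq, norm_planeWave]
        simp
      linear_combination (planeWave n p.1 * planeWave n p.2) * this
    rw [mul_assoc (V (p.1 - p.2) : ℂ), mul_assoc (V (p.1 - p.2) : ℂ), e1, planeWave_apply_sub]
    simp [energyDensity]
    ring
  have i1 := integrable_sub_mul_snd hVp (integrable_const (1 : ℂ))
  have i2 := integrable_sub_mul_snd hVp (integrable_planeWave (n + n))
  have h4 : ∫ x, (V x : ℂ) * planeWave n x = conj (fourierTransform V n) := by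
    rw [fourierTransform_eq, ← integral_conj]
    simp
  unfold energy
  simp_rw [h1]
  have h5 := integral_re ((i1.add i2).const_mul (1 / 2 : ℂ))
  refine h5.trans ?_
  rw [integral_const_mul]
  simp only [Pi.add_apply]
  rw [integral_add i1 i2, integral_sub_mul_snd hVp (integrable_const (1 : ℂ)),
    integral_sub_mul_snd hVp (integrable_planeWave (n + n)), integral_planeWave h2n, h4,
    integral_const, volume_real_univ]
  have h6 : (1 / 2 : ℂ) * (conj (fourierTransform V n) * (L ^ d • (1 : ℂ)) +
      conj (fourierTransform V n) * 0) =
      conj (fourierTransform V n) * ((L ^ d / 2 : ℝ) : ℂ) := by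
    rw [Complex.real_smul]
    push_cast
    ring
  rw [h6]
  refine (Complex.re_mul_ofReal _ _).trans ?_
  rw [Complex.conj_re, fourierReal, mul_comm]

end

end McKeanVlasov

/-! ### Convexity of the entropy and minimization among bounded densities -/

namespace McKeanVlasov

noncomputable section

open Filter Topology

/-- The convex function `x log x` lies above its tangent at `y`; for `x > 0` this is `log t ≤ t - 1`
at `t = y / x`. -/
lemma mul_log_tangent_le {x y : ℝ} (hx : 0 ≤ x) (hy : 0 < y) :
    y * Real.log y + (1 + Real.log y) * (x - y) ≤ x * Real.log x := by
  rcases hx.eq_or_lt with rfl | hx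
  · simp
    nlinarith
  · have h := Real.log_le_sub_one_of_pos (div_pos hy hx)
    rw [Real.log_div hy.ne' hx.ne'] at h
    have h1 := mul_le_mul_of_nonneg_left h hx.le
    have h2 : x * (y / x - 1) = y - x := by
      field_simp
    nlinarith

lemma mul_log_tangent_lt {x y : ℝ} (hx : 0 ≤ x) (hy : 0 < y) (hxy : x ≠ y) :
    y * Real.log y + (1 + Real.log y) * (x - y) < x * Real.log x := by
  rcases hx.eq_or_lt with rfl | hx
  · simp
    nlinarith
  · have h := Real.log_lt_sub_one_of_pos (div_pos hy hx) (by
      rw [Ne, div_eq_one_iff_eq hx.ne']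
      exact hxy.symm)
    rw [Real.log_div hy.ne' hx.ne'] at h
    have h1 := mul_lt_mul_of_pos_left h hx
    have h2 : x * (y / x - 1) = y - x := by
      field_simp
    nlinarith

lemma neg_one_le_mul_log {x : ℝ} (hx : 0 ≤ x) : -1 ≤ x * Real.log x := by
  have := mul_log_tangent_le hx one_pos
  simp at this
  linarith

/-- The second derivative of `x log x` is `1 / x`, at least `1 / C` on this interval, which is the
second derivative of the subtracted square. -/
lemma convexOn_mul_log_sub_sq (C : ℝ) :
    ConvexOn ℝ (Set.Icc 0 C) fun x => x * Real.log x - x ^ 2 / (2 * C) := by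
  refine MonotoneOn.convexOn_of_deriv (convex_Icc 0 C)
    ((Real.continuous_mul_log.sub (by fun_prop)).continuousOn) ?_ ?_
  · rw [interior_Icc]
    intro x hx
    exact ((Real.hasDerivAt_mul_log hx.1.ne').differentiableAt.sub
      (by fun_prop)).differentiableWithinAt
  · rw [interior_Icc]
    have hd : ∀ x ∈ Set.Ioo 0 C,
        deriv (fun x => x * Real.log x - x ^ 2 / (2 * C)) x = Real.log x + 1 - x / C := by
      intro x hx
      have hC : C ≠ 0 := (hx.1.trans hx.2).ne'
      have h := (Real.hasDerivAt_mul_log hx.1.ne').sub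
        (((hasDerivAt_id x).pow 2).div_const (2 * C))
      refine HasDerivAt.deriv (h.congr_deriv ?_)
      simp
      field_simp
    intro x hx y hy hxy
    rw [hd x hx, hd y hy]
    have hC : 0 < C := hx.1.trans hx.2
    have h1 := Real.log_le_sub_one_of_pos (div_pos hx.1 hy.1)
    rw [Real.log_div hx.1.ne' hy.1.ne'] at h1
    have h2 : (y - x) / C ≤ (y - x) / y :=
      div_le_div_of_nonneg_left (sub_nonneg.mpr hxy) hy.1 hy.2.le
    rw [sub_div, sub_div, div_self hy.1.ne'] at h2
    linarith

/-- Midpoint convexity of the preceding function. The quadratic gain is what later makes minimizing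
sequences Cauchy in mean square. -/
lemma mul_log_midpoint_le {C x y : ℝ} (hx : x ∈ Set.Icc 0 C) (hy : y ∈ Set.Icc 0 C) (hC : 0 < C) :
    (x + y) / 2 * Real.log ((x + y) / 2) ≤
      (x * Real.log x + y * Real.log y) / 2 - (x - y) ^ 2 / (8 * C) := by
  have h := (convexOn_mul_log_sub_sq C).2 hx hy (show (0 : ℝ) ≤ 1 / 2 by norm_num)
    (show (0 : ℝ) ≤ 1 / 2 by norm_num) (by norm_num)
  simp only [smul_eq_mul] at h
  have e : 1 / 2 * x + 1 / 2 * y = (x + y) / 2 := by ring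
  rw [e] at h
  have e2 : ((x + y) / 2) ^ 2 / (2 * C) =
      (x ^ 2 / (2 * C) + y ^ 2 / (2 * C)) / 2 - (x - y) ^ 2 / (8 * C) := by
    field_simp
    ring
  linarith

variable {d : ℕ} {L : ℝ} [Fact (0 < L)]

/-- The free energy as a real number, for densities at which it is finite. -/
def realFreeEnergy (V : Torus d L → ℝ) (θ : ℝ) (ρ : Torus d L → ℝ) : ℝ :=
  (∫ x, ρ x * Real.log (ρ x)) + θ / 2 * L ^ d * energy V ρ ρ

lemma freeEnergy_eq_coe {V ρ : Torus d L → ℝ} (θ : ℝ)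
    (hS : Integrable (fun x => ρ x * Real.log (ρ x)) volume)
    (hE : Integrable (energyDensity V ρ ρ) volume) :
    freeEnergy V θ ρ = (realFreeEnergy V θ ρ : EReal) := by
  rw [freeEnergy, entropy, selfEnergy, if_pos hS, if_pos hE, ← EReal.coe_mul, ← EReal.coe_add,
    realFreeEnergy]

lemma entropy_congr {ρ σ : Torus d L → ℝ} (h : ρ =ᵐ[volume] σ) : entropy ρ = entropy σ := by
  have h1 : (fun x => ρ x * Real.log (ρ x)) =ᵐ[volume] fun x => σ x * Real.log (σ x) := by
    filter_upwards [h] with x hx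
    rw [hx]
  rw [entropy, entropy, integrable_congr h1, integral_congr_ae h1]

lemma selfEnergy_congr {V ρ σ : Torus d L → ℝ} (h : ρ =ᵐ[volume] σ) :
    selfEnergy V ρ = selfEnergy V σ := by
  have h1 := energyDensity_ae_congr (V := V) h h
  rw [selfEnergy, selfEnergy, integrable_congr h1, energy, energy, integral_congr_ae h1]

lemma freeEnergy_congr {V ρ σ : Torus d L → ℝ} (θ : ℝ) (h : ρ =ᵐ[volume] σ) :
    freeEnergy V θ ρ = freeEnergy V θ σ := by
  rw [freeEnergy, freeEnergy, entropy_congr h, selfEnergy_congr h]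

lemma entropy_ne_bot (ρ : Torus d L → ℝ) : entropy ρ ≠ ⊥ := by
  rw [entropy]
  split_ifs
  · exact EReal.coe_ne_bot _
  · exact top_ne_bot

/-- Positivity of `θ` matters: at `θ = 0` the product `0 * ⊤` is `0` and hides a divergent energy.
-/
lemma integrable_energyDensity_of_freeEnergy_ne_top {V ρ : Torus d L → ℝ} {θ : ℝ} (hθ : 0 < θ)
    (h : freeEnergy V θ ρ ≠ ⊤) : Integrable (energyDensity V ρ ρ) volume := by
  have hL : (0 : ℝ) < L := Fact.out
  by_contra hE
  apply h
  rw [freeEnergy, selfEnergy, if_neg hE, EReal.coe_mul_top_of_pos (by positivity)]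
  exact EReal.add_top_of_ne_bot (entropy_ne_bot ρ)

lemma integrable_mul_log_of_freeEnergy_ne_top {V ρ : Torus d L → ℝ} {θ : ℝ} (hθ : 0 ≤ θ)
    (h : freeEnergy V θ ρ ≠ ⊤) : Integrable (fun x => ρ x * Real.log (ρ x)) volume := by
  have hL : (0 : ℝ) < L := Fact.out
  by_contra hS
  apply h
  rw [freeEnergy, entropy, if_neg hS]
  refine EReal.top_add_of_ne_bot ?_
  rcases hθ.eq_or_lt with rfl | hθ
  · simp
  · rw [selfEnergy]
    split_ifs
    · rw [← EReal.coe_mul]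
      exact EReal.coe_ne_bot _
    · rw [EReal.coe_mul_top_of_pos (by positivity)]
      exact top_ne_bot

/-- The probability densities with values in `[0, C]`. -/
structure IsBoundedDensity (C : ℝ) (ρ : Torus d L → ℝ) : Prop where
  measurable : Measurable ρ
  mem_Icc : ∀ x, ρ x ∈ Set.Icc 0 C
  integral_eq_one : ∫ x, ρ x = 1

namespace IsBoundedDensity

variable {C : ℝ} {ρ σ : Torus d L → ℝ}

lemma abs_le (hρ : IsBoundedDensity C ρ) (x : Torus d L) : |ρ x| ≤ C := by
  rw [abs_of_nonneg (hρ.mem_Icc x).1]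
  exact (hρ.mem_Icc x).2

lemma integrable (hρ : IsBoundedDensity C ρ) : Integrable ρ volume :=
  Integrable.of_bound hρ.measurable.aestronglyMeasurable C (Eventually.of_forall hρ.abs_le)

lemma isDensity (hρ : IsBoundedDensity C ρ) : IsDensity ρ :=
  ⟨hρ.integrable, Eventually.of_forall fun x => (hρ.mem_Icc x).1, hρ.integral_eq_one⟩

end IsBoundedDensity

lemma exists_bound_mul_log (C : ℝ) : ∃ K, ∀ x ∈ Set.Icc 0 C, |x * Real.log x| ≤ K := by
  obtain ⟨K, hK⟩ := isCompact_Icc.exists_bound_of_continuousOn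
    (Real.continuous_mul_log.continuousOn (s := Set.Icc 0 C))
  exact ⟨K, hK⟩

namespace IsBoundedDensity

variable {C : ℝ} {ρ σ : Torus d L → ℝ}

lemma integrable_mul_log (hρ : IsBoundedDensity C ρ) :
    Integrable (fun x => ρ x * Real.log (ρ x)) volume := by
  obtain ⟨K, hK⟩ := exists_bound_mul_log C
  exact Integrable.of_bound (Real.continuous_mul_log.measurable.comp
    hρ.measurable).aestronglyMeasurable K (Eventually.of_forall fun x => hK _ (hρ.mem_Icc x))

lemma integrable_energyDensity {V : Torus d L → ℝ} (hV : Integrable V volume)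
    (hρ : IsBoundedDensity C ρ) (hσ : IsBoundedDensity C σ) :
    Integrable (energyDensity V ρ σ) volume :=
  integrable_energyDensity_of_bdd_left hV hρ.integrable.1 (Eventually.of_forall hρ.abs_le)
    hσ.integrable

lemma freeEnergy_eq {V : Torus d L → ℝ} (hV : Integrable V volume) (θ : ℝ)
    (hρ : IsBoundedDensity C ρ) : freeEnergy V θ ρ = (realFreeEnergy V θ ρ : EReal) :=
  freeEnergy_eq_coe θ hρ.integrable_mul_log (hρ.integrable_energyDensity hV hρ)

lemma midpoint (hρ : IsBoundedDensity C ρ) (hσ : IsBoundedDensity C σ) :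
    IsBoundedDensity C fun x => (ρ x + σ x) / 2 where
  measurable := (hρ.measurable.add hσ.measurable).div_const 2
  mem_Icc x := by
    have h1 := hρ.mem_Icc x
    have h2 := hσ.mem_Icc x
    constructor <;> linarith [h1.1, h1.2, h2.1, h2.2]
  integral_eq_one := by
    rw [integral_div, integral_add hρ.integrable hσ.integrable, hρ.integral_eq_one,
      hσ.integral_eq_one]
    norm_num

/-- The parallelogram estimate for the free energy. -/
lemma realFreeEnergy_midpoint_le {V : Torus d L → ℝ} (hV : Integrable V volume) (θ : ℝ)
    (hC : 0 < C) (hρ : IsBoundedDensity C ρ) (hσ : IsBoundedDensity C σ) :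
    realFreeEnergy V θ (fun x => (ρ x + σ x) / 2) ≤
      (realFreeEnergy V θ ρ + realFreeEnergy V θ σ) / 2 -
        (∫ x, (ρ x - σ x) ^ 2) / (8 * C) -
        θ / 8 * L ^ d * energy V (fun x => ρ x - σ x) (fun x => ρ x - σ x) := by
  have hsq : Integrable (fun x => (ρ x - σ x) ^ 2) volume := by
    refine integrable_sq_of_bdd (M := C) (hρ.integrable.sub hσ.integrable)
      (Eventually.of_forall fun x => ?_)
    have h1 := hρ.mem_Icc x
    have h2 := hσ.mem_Icc x
    rw [_root_.abs_le]
    constructor <;> linarith [h1.1, h1.2, h2.1, h2.2]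
  have hS : ∫ x, (ρ x + σ x) / 2 * Real.log ((ρ x + σ x) / 2) ≤
      ((∫ x, ρ x * Real.log (ρ x)) + ∫ x, σ x * Real.log (σ x)) / 2 -
        (∫ x, (ρ x - σ x) ^ 2) / (8 * C) := by
    have hadd : Integrable (fun x => (ρ x * Real.log (ρ x) + σ x * Real.log (σ x)) / 2) volume :=
      (hρ.integrable_mul_log.add hσ.integrable_mul_log).div_const 2
    rw [← integral_add hρ.integrable_mul_log hσ.integrable_mul_log, ← integral_div,
      ← integral_div, ← integral_sub hadd (hsq.div_const _)]
    exact integral_mono (hρ.midpoint hσ).integrable_mul_log (hadd.sub (hsq.div_const _)) fun x => mul_log_midpoint_le (hρ.mem_Icc x) (hσ.mem_Icc x) hC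
  have e1 := hρ.integrable_energyDensity hV hρ
  have e2 := hρ.integrable_energyDensity hV hσ
  have e3 := hσ.integrable_energyDensity hV hρ
  have e4 := hσ.integrable_energyDensity hV hσ
  have hE : energy V (fun x => (ρ x + σ x) / 2) (fun x => (ρ x + σ x) / 2) =
      (energy V ρ ρ + energy V σ σ) / 2 -
        energy V (fun x => ρ x - σ x) (fun x => ρ x - σ x) / 4 := by
    have hadd := energy_add_add e1 e2 e3 e4
    have hsub : energy V (fun x => ρ x - σ x) (fun x => ρ x - σ x) =
        energy V ρ ρ - energy V ρ σ - energy V σ ρ + energy V σ σ := by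
      have h1 := integral_add' ((e1.sub e2).sub e3) e4
      rw [integral_sub' (e1.sub e2) e3, integral_sub' e1 e2] at h1
      unfold energy
      rw [← h1]
      congr 1
      ext p
      simp only [energyDensity, Pi.add_apply, Pi.sub_apply]
      ring
    have hhalf : energy V (fun x => (ρ x + σ x) / 2) (fun x => (ρ x + σ x) / 2) =
        energy V (fun x => ρ x + σ x) (fun x => ρ x + σ x) / 4 := by
      unfold energy
      rw [← integral_div]
      congr 1
      ext p
      simp only [energyDensity]
      ring
    rw [hhalf, hadd, hsub]
    ring
  unfold realFreeEnergy
  rw [hE]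
  linarith

lemma neg_le_realFreeEnergy {V : Torus d L → ℝ} (hV : Integrable V volume) {θ : ℝ} (hθ : 0 ≤ θ)
    (hρ : IsBoundedDensity C ρ) :
    -L ^ d - θ / 2 * L ^ d * (C * ∫ x, |V x|) ≤ realFreeEnergy V θ ρ := by
  have hL : (0 : ℝ) < L := Fact.out
  have h1 : -L ^ d ≤ ∫ x, ρ x * Real.log (ρ x) := by
    have := integral_mono (integrable_const (-1 : ℝ)) hρ.integrable_mul_log
      fun x => neg_one_le_mul_log (hρ.mem_Icc x).1
    rw [integral_const, volume_real_univ, smul_eq_mul] at this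
    linarith
  have h2 : |energy V ρ ρ| ≤ C * ∫ x, |V x| := by
    have h3 := integral_sub_mul_snd (𝕜 := ℝ) hV.abs hρ.integrable
    rw [hρ.integral_eq_one, mul_one] at h3
    rw [← h3, ← integral_const_mul]
    change ‖∫ p, energyDensity V ρ ρ p‖ ≤ _
    refine norm_integral_le_of_norm_le ((integrable_sub_mul_snd (𝕜 := ℝ) hV.abs hρ.integrable).const_mul C)
      (Eventually.of_forall fun p => ?_)
    simp only [energyDensity, Real.norm_eq_abs, abs_mul]
    rw [abs_of_nonneg (hρ.mem_Icc p.2).1]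
    have h4 := hρ.abs_le p.1
    have h5 := (hρ.mem_Icc p.2).1
    calc |V (p.1 - p.2)| * |ρ p.1| * ρ p.2 ≤ |V (p.1 - p.2)| * C * ρ p.2 := by gcongr
      _ = C * (|V (p.1 - p.2)| * ρ p.2) := by ring
  have h3 := (_root_.abs_le.mp h2).1
  have h4 : 0 ≤ θ / 2 * L ^ d := by positivity
  have h5 := mul_le_mul_of_nonneg_left h3 h4
  unfold realFreeEnergy
  linarith

end IsBoundedDensity

lemma isBoundedDensity_uniformDensity {C : ℝ} (hC : (L ^ d)⁻¹ ≤ C) :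
    IsBoundedDensity C (uniformDensity d L) where
  measurable := measurable_const
  mem_Icc _ := by
    have hL : (0 : ℝ) < L := Fact.out
    exact ⟨by unfold uniformDensity; positivity, hC⟩
  integral_eq_one := by
    have hL : (0 : ℝ) < L := Fact.out
    unfold uniformDensity
    rw [integral_const, volume_real_univ, smul_eq_mul, mul_inv_cancel₀ (by positivity)]

/-- Almost everywhere limits of densities with values in `[0, C]`. -/
lemma exists_isBoundedDensity_limit {V : Torus d L → ℝ} (hV : Integrable V volume) (θ : ℝ) {C : ℝ}
    {ρ : ℕ → Torus d L → ℝ} (hρ : ∀ j, IsBoundedDensity C (ρ j)) {g : Torus d L → ℝ}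
    (hg : AEStronglyMeasurable g volume)
    (hlim : ∀ᵐ x, Tendsto (fun j => ρ j x) atTop (𝓝 (g x))) :
    ∃ σ : Torus d L → ℝ, IsBoundedDensity C σ ∧
      Tendsto (fun j => realFreeEnergy V θ (ρ j)) atTop (𝓝 (realFreeEnergy V θ σ)) := by
  have hC0 : 0 ≤ C := (Set.nonempty_Icc.mp ⟨_, (hρ 0).mem_Icc 0⟩)
  -- A measurable representative clamped to `[0, C]`, because `IsBoundedDensity` asks for its bounds
  -- everywhere and not just almost everywhere.
  set σ : Torus d L → ℝ := fun x => max 0 (min (hg.mk g x) C) with hσ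
  have hσm : Measurable σ :=
    measurable_const.max (hg.stronglyMeasurable_mk.measurable.min measurable_const)
  have hσI : ∀ x, σ x ∈ Set.Icc 0 C := fun x =>
    ⟨le_max_left _ _, max_le hC0 (min_le_right _ _)⟩
  have hσlim : ∀ᵐ x, Tendsto (fun j => ρ j x) atTop (𝓝 (σ x)) := by
    filter_upwards [hlim, hg.ae_eq_mk] with x hx hgx
    have h1 : g x ∈ Set.Icc 0 C :=
      isClosed_Icc.mem_of_tendsto hx (Eventually.of_forall fun j => (hρ j).mem_Icc x)
    rw [hσ]
    simp only
    rw [← hgx, min_eq_left h1.2, max_eq_right h1.1]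
    exact hx
  have hint : Tendsto (fun j => ∫ x, ρ j x) atTop (𝓝 (∫ x, σ x)) :=
    tendsto_integral_of_dominated_convergence (fun _ => C)
      (fun j => (hρ j).measurable.aestronglyMeasurable) (integrable_const _)
      (fun j => Eventually.of_forall (hρ j).abs_le) hσlim
  simp_rw [(hρ _).integral_eq_one] at hint
  refine ⟨σ, ⟨hσm, hσI, (tendsto_nhds_unique hint tendsto_const_nhds)⟩, ?_⟩
  refine Tendsto.add ?_ (Tendsto.const_mul _ ?_)
  · obtain ⟨K, hK⟩ := exists_bound_mul_log C
    refine tendsto_integral_of_dominated_convergence (fun _ => K)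
      (fun j => (hρ j).integrable_mul_log.1) (integrable_const _)
      (fun j => Eventually.of_forall fun x => hK _ ((hρ j).mem_Icc x)) ?_
    filter_upwards [hσlim] with x hx
    exact (Real.continuous_mul_log.tendsto _).comp hx
  · refine tendsto_integral_of_dominated_convergence (fun p => |V (p.1 - p.2) * C| * C)
      (fun j => ((hρ j).integrable_energyDensity hV (hρ j)).1)
      ?_ (fun j => Eventually.of_forall fun p => ?_) ?_
    · exact ((integrable_sub_mul_snd hV (integrable_const C)).abs).mul_const C
    · simp only [energyDensity, Real.norm_eq_abs, abs_mul]
      rw [abs_of_nonneg hC0]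
      have h1 := (hρ j).abs_le p.1
      have h2 := (hρ j).abs_le p.2
      gcongr
    · filter_upwards [quasiMeasurePreserving_fst.ae hσlim, quasiMeasurePreserving_snd.ae hσlim]
        with p h1 h2
      exact (tendsto_const_nhds.mul h1).mul h2

/-- A sequence of bounded functions which is Cauchy in the mean square has a subsequence that
converges almost everywhere. -/
lemma exists_subseq_tendsto_ae {ρ : ℕ → Torus d L → ℝ} {C : ℝ}
    (hρm : ∀ j, AEStronglyMeasurable (ρ j) volume) (hρ : ∀ j x, |ρ j x| ≤ C)
    (hcau : Tendsto (fun q : ℕ × ℕ => ∫ x, (ρ q.1 x - ρ q.2 x) ^ 2) atTop (𝓝 0)) :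
    ∃ (φ : ℕ → ℕ) (g : Torus d L → ℝ), StrictMono φ ∧ AEStronglyMeasurable g volume ∧
      ∀ᵐ x, Tendsto (fun j => ρ (φ j) x) atTop (𝓝 (g x)) := by
  have hL2 : ∀ j, MemLp (ρ j) 2 volume := fun j =>
    MemLp.of_bound (hρm j) C (Eventually.of_forall (hρ j))
  let f : ℕ → Lp ℝ 2 (volume : Measure (Torus d L)) := fun j => (hL2 j).toLp (ρ j)
  have hf : CauchySeq f := by
    rw [Lp.cauchySeq_Lp_iff_cauchySeq_eLpNorm]
    have h1 : ∀ q : ℕ × ℕ, eLpNorm (⇑(f q.1) - ⇑(f q.2)) 2 volume =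
        ENNReal.ofReal ((∫ x, (ρ q.1 x - ρ q.2 x) ^ 2) ^ (2⁻¹ : ℝ)) := by
      intro q
      have h2 : (⇑(f q.1) - ⇑(f q.2)) =ᵐ[volume] (ρ q.1 - ρ q.2) :=
        ((hL2 q.1).coeFn_toLp).sub ((hL2 q.2).coeFn_toLp)
      rw [eLpNorm_congr_ae h2, ((hL2 q.1).sub (hL2 q.2)).eLpNorm_eq_integral_rpow_norm
        (by norm_num) (by norm_num)]
      simp
    simp_rw [h1]
    have h3 := (hcau.rpow_const (p := (2⁻¹ : ℝ)) (Or.inr (by norm_num)))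
    rw [Real.zero_rpow (by norm_num)] at h3
    simpa using ENNReal.tendsto_ofReal h3
  obtain ⟨g, hg⟩ := cauchySeq_tendsto_of_complete hf
  obtain ⟨φ, hφ, hφg⟩ := (tendstoInMeasure_of_tendsto_Lp hg).exists_seq_tendsto_ae
  refine ⟨φ, g, hφ, Lp.aestronglyMeasurable g, ?_⟩
  have h4 : ∀ᵐ x, ∀ j, f j x = ρ j x := ae_all_iff.mpr fun j => (hL2 j).coeFn_toLp
  filter_upwards [hφg, h4] with x hx h4x
  simpa [h4x] using hx

/-- The free energy has a minimizer among the densities with values in `[0, C]`. -/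
lemma exists_isBoundedDensity_minimizer {V : Torus d L → ℝ} (hV : Integrable V volume) {θ : ℝ}
    (hθ : 0 ≤ θ) {C : ℝ} (hC : (L ^ d)⁻¹ ≤ C) :
    ∃ ρ : Torus d L → ℝ, IsBoundedDensity C ρ ∧
      ∀ σ, IsBoundedDensity C σ → realFreeEnergy V θ ρ ≤ realFreeEnergy V θ σ := by
  have hL : (0 : ℝ) < L := Fact.out
  have hLd : 0 < L ^ d := pow_pos hL d
  have hC0 : 0 < C := (inv_pos.mpr hLd).trans_le hC
  set A : Set ℝ := realFreeEnergy V θ '' {ρ | IsBoundedDensity C ρ} with hA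
  have hAne : A.Nonempty := ⟨_, _, isBoundedDensity_uniformDensity hC, rfl⟩
  have hAb : BddBelow A := ⟨_, by
    rintro _ ⟨ρ, hρ, rfl⟩
    exact IsBoundedDensity.neg_le_realFreeEnergy hV hθ hρ⟩
  obtain ⟨u, -, hu, huA⟩ := exists_seq_tendsto_sInf hAne hAb
  choose ρ hρ hρu using huA
  have hρ : ∀ j, IsBoundedDensity C (ρ j) := hρ
  -- Coefficients of probability densities lie in the closed unit disc, so by compactness of the
  -- countable product a subsequence converges at every wave vector simultaneously.
  have hcomp : IsCompact (Set.univ.pi fun _ : Fin d → ℤ => Metric.closedBall (0 : ℂ) 1) :=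
    isCompact_univ_pi fun _ => isCompact_closedBall _ _
  obtain ⟨ℓ, -, φ, hφ, hℓ⟩ := hcomp.tendsto_subseq
    (x := fun j => fourierTransform (ρ j)) (fun j n _ => by
      rw [mem_closedBall_zero_iff]
      refine (norm_fourierTransform_le _ _).trans (le_of_eq ?_)
      rw [← (hρ j).integral_eq_one]
      congr 1
      ext x
      exact abs_of_nonneg ((hρ j).mem_Icc x).1)
  rw [tendsto_pi_nhds] at hℓ
  have hlow : ∀ σ, IsBoundedDensity C σ → sInf A ≤ realFreeEnergy V θ σ := fun σ hσ =>
    csInf_le hAb ⟨σ, hσ, rfl⟩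
  have hGlim : Tendsto (fun j => realFreeEnergy V θ (ρ (φ j))) atTop (𝓝 (sInf A)) := by
    simp_rw [hρu]
    exact hu.comp hφ.tendsto_atTop
  have hcau : Tendsto (fun q : ℕ × ℕ => ∫ x, (ρ (φ q.1) x - ρ (φ q.2) x) ^ 2) atTop (𝓝 0) := by
    have hE0 : Tendsto (fun q : ℕ × ℕ => energy V (fun x => ρ (φ q.1) x - ρ (φ q.2) x)
        (fun x => ρ (φ q.1) x - ρ (φ q.2) x)) atTop (𝓝 0) := by
      rw [Metric.tendsto_nhds]
      intro ε hε
      have := eventually_abs_energy_sub_le hV (ρ := fun j => ρ (φ j))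
        (fun j => (hρ _).integrable) (fun j => (hρ _).abs_le) hℓ (half_pos hε)
      filter_upwards [this] with q hq
      rw [dist_zero_right, Real.norm_eq_abs]
      linarith
    have hG1 : Tendsto (fun q : ℕ × ℕ => realFreeEnergy V θ (ρ (φ q.1))) atTop (𝓝 (sInf A)) := by
      rw [← prod_atTop_atTop_eq]
      exact hGlim.comp tendsto_fst
    have hG2 : Tendsto (fun q : ℕ × ℕ => realFreeEnergy V θ (ρ (φ q.2))) atTop (𝓝 (sInf A)) := by
      rw [← prod_atTop_atTop_eq]
      exact hGlim.comp tendsto_snd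
    -- The midpoint is itself a competitor, so its free energy is at least the infimum. The
    -- parallelogram estimate then bounds the mean square distance by the excess over the infimum
    -- and the energy of the difference, both of which vanish.
    refine squeeze_zero (g := fun q : ℕ × ℕ => 8 * C * (((realFreeEnergy V θ (ρ (φ q.1)) +
      realFreeEnergy V θ (ρ (φ q.2))) / 2 - sInf A) - θ / 8 * L ^ d * energy V
        (fun x => ρ (φ q.1) x - ρ (φ q.2) x) (fun x => ρ (φ q.1) x - ρ (φ q.2) x)))
      (fun q => integral_nonneg fun x => sq_nonneg _) (fun q => ?_) ?_
    · have h1 := (hρ (φ q.1)).realFreeEnergy_midpoint_le hV θ hC0 (hρ (φ q.2))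
      have h2 := hlow _ ((hρ (φ q.1)).midpoint (hρ (φ q.2)))
      rw [← div_le_iff₀' (by positivity)]
      linarith
    · have := ((((hG1.add hG2).div_const 2).sub_const (sInf A)).sub
        (hE0.const_mul (θ / 8 * L ^ d))).const_mul (8 * C)
      convert this using 2
      ring
  obtain ⟨ψ, g, hψ, hg, hlim⟩ := exists_subseq_tendsto_ae (ρ := fun j => ρ (φ j))
    (fun j => (hρ _).integrable.1) (fun j => (hρ _).abs_le) hcau
  obtain ⟨σ, hσ, hσlim⟩ := exists_isBoundedDensity_limit hV θ
    (ρ := fun j => ρ (φ (ψ j))) (fun j => hρ _) hg hlim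
  refine ⟨σ, hσ, fun τ hτ => ?_⟩
  rw [tendsto_nhds_unique hσlim (hGlim.comp hψ.tendsto_atTop)]
  exact hlow τ hτ

end

end McKeanVlasov

/-! ### Existence of minimizers, uniqueness for positive type, and instability of the uniform
density -/

namespace McKeanVlasov

noncomputable section

open Filter Topology

variable {d : ℕ} {L : ℝ} [Fact (0 < L)]

lemma exists_ae_neg_le {a : ℝ} {V : Torus d L → ℝ} (hV : IsInteraction a V) :
    ∃ b : ℝ, 0 ≤ b ∧ ∀ᵐ x, -V x ≤ b := by
  refine ⟨(eLpNormEssSup (fun x => max (-V x) 0) volume).toReal, ENNReal.toReal_nonneg, ?_⟩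
  have hfin : eLpNormEssSup (fun x => max (-V x) 0) volume ≠ ⊤ := by
    have := hV.negPart_bounded.2
    rw [eLpNorm_exponent_top] at this
    exact this.ne
  filter_upwards [ae_le_eLpNormEssSup (f := fun x => max (-V x) 0)
    (μ := (volume : Measure (Torus d L)))] with x hx
  have h1 := (ENNReal.toReal_le_toReal (by simp) hfin).mpr hx
  rw [toReal_enorm, Real.norm_eq_abs] at h1
  exact (le_max_left _ _).trans ((le_abs_self _).trans h1)

/-- Moving the mass of `{ρ > C}` to the region where `ρ` is at most twice its mean does not
increase the free energy, if `C` is large enough. -/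
lemma exists_isBoundedDensity_le {a : ℝ} {V : Torus d L → ℝ} (hV : IsInteraction a V) {θ : ℝ}
    (hθ : 0 ≤ θ) :
    ∃ C : ℝ, (L ^ d)⁻¹ ≤ C ∧ ∀ σ : Torus d L → ℝ, Measurable σ → (∀ x, 0 ≤ σ x) →
      Integrable σ volume → ∫ x, σ x = 1 →
      Integrable (fun x => σ x * Real.log (σ x)) volume →
      Integrable (energyDensity V σ σ) volume →
      ∃ ρ : Torus d L → ℝ, IsBoundedDensity C ρ ∧
        realFreeEnergy V θ ρ ≤ realFreeEnergy V θ σ := by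
  have hL : (0 : ℝ) < L := Fact.out
  have hLd : 0 < L ^ d := pow_pos hL d
  obtain ⟨b, hb0, hb⟩ := exists_ae_neg_le hV
  set r : ℝ := (L ^ d)⁻¹ with hr
  have hr0 : 0 < r := inv_pos.mpr hLd
  set W : ℝ := ∫ x, |V x| with hW
  have hW0 : 0 ≤ W := integral_nonneg fun x => abs_nonneg _
  -- Moving mass `m` changes the entropy by at most `m * (1 + log (4 * r) - log C)` and the energy
  -- by at most `m * (4 * r * W + 2 * b)`. This `E` makes the two bounds, weighted as in the free
  -- energy, cancel exactly.
  set E : ℝ := 1 + θ / 2 * L ^ d * (4 * r * W + 2 * b) with hE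
  have hE0 : 0 ≤ E := by positivity
  set C : ℝ := 4 * r * Real.exp E with hC
  have h4rC : 4 * r ≤ C := le_mul_of_one_le_right (by positivity) (Real.one_le_exp hE0)
  have hC0 : 0 < C := by positivity
  have hlogC : Real.log C = Real.log (4 * r) + E := by
    rw [hC, Real.log_mul (by positivity) (Real.exp_pos _).ne', Real.log_exp]
  refine ⟨C, by linarith, fun σ hσm hσ0 hσi hσ1 hσS hσE => ?_⟩
  set A : Set (Torus d L) := {x | σ x ≤ 2 * r} with hA
  set B : Set (Torus d L) := {x | C < σ x} with hB
  have hAm : MeasurableSet A := measurableSet_le hσm measurable_const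
  have hBm : MeasurableSet B := measurableSet_lt measurable_const hσm
  set α : ℝ := (volume : Measure (Torus d L)).real A with hα
  -- Markov's inequality: a density of mean `r` exceeds `2 * r` on at most half the volume.
  have hα1 : L ^ d / 2 ≤ α := by
    have h1 : ∫ x, Aᶜ.indicator (fun _ => 2 * r) x ≤ ∫ x, σ x := by
      refine integral_mono ((integrable_const (2 * r)).indicator hAm.compl) hσi fun x => ?_
      refine Set.indicator_le' (fun x hx => ?_) (fun x _ => hσ0 x) x
      have hx' : ¬ σ x ≤ 2 * r := hx
      exact (not_le.mp hx').le
    rw [integral_indicator_const _ hAm.compl, hσ1, smul_eq_mul, measureReal_compl hAm,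
      volume_real_univ, ← hα, hr] at h1
    field_simp at h1
    linarith
  have hα0 : 0 < α := by linarith [half_pos hLd]
  set β : Torus d L → ℝ := B.indicator σ with hβ
  have hβm : Measurable β := hσm.indicator hBm
  have hβi : Integrable β volume := hσi.indicator hBm
  have hβ0 : ∀ x, 0 ≤ β x := fun x => Set.indicator_nonneg (fun x _ => hσ0 x) x
  have hβσ : ∀ x, β x ≤ σ x := fun x => Set.indicator_le_self' (fun x _ => hσ0 x) x
  set m : ℝ := ∫ x, β x with hm
  have hm0 : 0 ≤ m := integral_nonneg hβ0
  have hm1 : m ≤ 1 := by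
    rw [← hσ1]
    exact integral_mono hβi hσi hβσ
  -- The height of the moved mass when spread evenly over `A`. It is at most `2 * r`, so the new
  -- values there stay below `4 * r ≤ C`.
  set s : ℝ := m / α with hs
  have hs0 : 0 ≤ s := by positivity
  have hs2 : s ≤ 2 * r * m := by
    rw [hs, div_le_iff₀ hα0, hr]
    have : 2 * (L ^ d)⁻¹ * m * (L ^ d / 2) ≤ 2 * (L ^ d)⁻¹ * m * α := by gcongr
    refine le_trans (le_of_eq ?_) this
    field_simp
  have hs3 : s ≤ 2 * r := hs2.trans (mul_le_of_le_one_right (by positivity) hm1)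
  set γ : Torus d L → ℝ := A.indicator fun _ => s with hγ
  have hγm : Measurable γ := measurable_const.indicator hAm
  have hγi : Integrable γ volume := (integrable_const s).indicator hAm
  have hγ0 : ∀ x, 0 ≤ γ x := fun x => Set.indicator_nonneg (fun x _ => hs0) x
  have hγs : ∀ x, γ x ≤ s := fun x => Set.indicator_le' (fun x _ => le_rfl) (fun x _ => hs0) x
  have hγint : ∫ x, γ x = m := by
    rw [hγ, integral_indicator_const _ hAm, smul_eq_mul, ← hα, hs]
    field_simp
  set ρ : Torus d L → ℝ := fun x => σ x + γ x - β x with hρ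
  have hcases : ∀ x, (β x = 0 ∧ γ x = s ∧ σ x ≤ 2 * r) ∨ (β x = σ x ∧ γ x = 0 ∧ C < σ x) ∨
      (β x = 0 ∧ γ x = 0 ∧ σ x ≤ C) := by
    intro x
    by_cases hxA : x ∈ A
    · left
      have hxB : x ∉ B := fun h => by
        have h1 : σ x ≤ 2 * r := hxA
        have h2 : C < σ x := h
        linarith
      exact ⟨Set.indicator_of_notMem hxB _, Set.indicator_of_mem hxA _, hxA⟩
    · right
      by_cases hxB : x ∈ B
      · left
        exact ⟨Set.indicator_of_mem hxB _, Set.indicator_of_notMem hxA _, hxB⟩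
      · right
        exact ⟨Set.indicator_of_notMem hxB _, Set.indicator_of_notMem hxA _, not_lt.mp hxB⟩
  have hρI : IsBoundedDensity C ρ := by
    refine ⟨(hσm.add hγm).sub hβm, fun x => ?_, ?_⟩
    · have h1 := hσ0 x
      simp only [hρ, Set.mem_Icc]
      rcases hcases x with ⟨e1, e2, h2⟩ | ⟨e1, e2, h2⟩ | ⟨e1, e2, h2⟩ <;> rw [e1, e2] <;>
        constructor <;> linarith
    · have h1 := integral_sub' (hσi.add hγi) hβi
      rw [integral_add' hσi hγi, hσ1, hγint, ← hm, add_sub_cancel_right] at h1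
      exact h1
  refine ⟨ρ, hρI, ?_⟩
  have hS : (∫ x, ρ x * Real.log (ρ x)) - ∫ x, σ x * Real.log (σ x) ≤
      (1 + Real.log (4 * r)) * m - Real.log C * m := by
    rw [← integral_sub hρI.integrable_mul_log hσS]
    nth_rewrite 1 [← hγint]
    rw [hm, ← integral_const_mul, ← integral_const_mul,
      ← integral_sub (hγi.const_mul _) (hβi.const_mul _)]
    refine integral_mono (hρI.integrable_mul_log.sub hσS)
      ((hγi.const_mul _).sub (hβi.const_mul _)) fun x => ?_
    simp only [hρ]
    rcases hcases x with ⟨e1, e2, h2⟩ | ⟨e1, e2, h2⟩ | ⟨e1, e2, h2⟩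
    · rw [e1, e2]
      rcases hs0.eq_or_lt with hs0 | hs0
      · simp [← hs0]
      · have h3 := hσ0 x
        have h4 := mul_log_tangent_le h3 (show 0 < σ x + s by linarith)
        have h5 : Real.log (σ x + s) ≤ Real.log (4 * r) :=
          Real.log_le_log (by linarith) (by linarith)
        simp only [sub_zero, mul_zero]
        nlinarith
    · rw [e1, e2]
      have h3 : Real.log C ≤ Real.log (σ x) := Real.log_le_log hC0 h2.le
      have h4 := mul_le_mul_of_nonneg_right h3 (hσ0 x)
      simp
      linarith
    · rw [e1, e2]
      simp
  have hρσ : Integrable (energyDensity V ρ ρ) volume := hρI.integrable_energyDensity hV.integrable hρI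
  have hEn : energy V ρ ρ - energy V σ σ ≤ m * (4 * r * W + 2 * b) := by
    have i1 := integrable_sub_mul_fst (𝕜 := ℝ) hV.integrable.abs hρI.integrable
    have i2 := integrable_sub_mul_snd (𝕜 := ℝ) hV.integrable.abs hσi
    have i3 : Integrable (fun p : Torus d L × Torus d L => ρ p.1 * β p.2) volume :=
      hρI.integrable.mul_prod hβi
    have i4 : Integrable (fun p : Torus d L × Torus d L => β p.1 * σ p.2) volume :=
      hβi.mul_prod hσi
    have v1 := integral_sub_mul_fst (𝕜 := ℝ) hV.integrable.abs hρI.integrable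
    have v2 := integral_sub_mul_snd (𝕜 := ℝ) hV.integrable.abs hσi
    have v3 : ∫ p : Torus d L × Torus d L, ρ p.1 * β p.2 = (∫ x, ρ x) * ∫ x, β x :=
      integral_prod_mul ρ β
    have v4 : ∫ p : Torus d L × Torus d L, β p.1 * σ p.2 = (∫ x, β x) * ∫ x, σ x :=
      integral_prod_mul β σ
    have hle : energy V ρ ρ - energy V σ σ ≤ ∫ p : Torus d L × Torus d L,
        ((s * (|V (p.1 - p.2)| * ρ p.1) + s * (|V (p.1 - p.2)| * σ p.2)) +
          (b * (ρ p.1 * β p.2) + b * (β p.1 * σ p.2))) := by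
      unfold energy
      rw [← integral_sub hρσ hσE]
      refine integral_mono_ae (hρσ.sub hσE) (((i1.const_mul s).add (i2.const_mul s)).add
        ((i3.const_mul b).add (i4.const_mul b))) ?_
      filter_upwards [quasiMeasurePreserving_sub.ae hb] with p hp
      set v := V (p.1 - p.2) with hv
      have hρp : ∀ x, ρ x = σ x + γ x - β x := fun x => rfl
      -- The change is split one variable at a time. The added part `γ` is bounded by `s` and pairs
      -- with `|V|`; the removed part `β` may be unbounded but needs only the lower bound on `V`.
      have e : energyDensity V ρ ρ p - energyDensity V σ σ p =
          v * ρ p.1 * γ p.2 + v * γ p.1 * σ p.2 + (-v) * (ρ p.1 * β p.2) +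
            (-v) * (β p.1 * σ p.2) := by
        simp only [energyDensity, ← hv]
        linear_combination (v * ρ p.1) * hρp p.2 + (v * σ p.2) * hρp p.1
      rw [e]
      have hρ0 := (hρI.mem_Icc p.1).1
      have q1 : v * ρ p.1 * γ p.2 ≤ s * (|v| * ρ p.1) := by
        calc v * ρ p.1 * γ p.2 ≤ |v| * ρ p.1 * γ p.2 := by
              have := le_abs_self v
              have := hγ0 p.2
              gcongr
          _ ≤ |v| * ρ p.1 * s := by
              have := hγs p.2
              gcongr
          _ = _ := mul_comm _ _
      have q2 : v * γ p.1 * σ p.2 ≤ s * (|v| * σ p.2) := by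
        have h0 := hσ0 p.2
        calc v * γ p.1 * σ p.2 ≤ |v| * γ p.1 * σ p.2 := by
              have := le_abs_self v
              have := hγ0 p.1
              gcongr
          _ ≤ |v| * s * σ p.2 := by
              have := hγs p.1
              gcongr
          _ = _ := by ring
      have q3 : (-v) * (ρ p.1 * β p.2) ≤ b * (ρ p.1 * β p.2) :=
        mul_le_mul_of_nonneg_right hp (mul_nonneg hρ0 (hβ0 _))
      have q4 : (-v) * (β p.1 * σ p.2) ≤ b * (β p.1 * σ p.2) :=
        mul_le_mul_of_nonneg_right hp (mul_nonneg (hβ0 _) (hσ0 _))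
      linarith
    have hsum := integral_add' ((i1.const_mul s).add (i2.const_mul s))
      ((i3.const_mul b).add (i4.const_mul b))
    rw [integral_add' (i1.const_mul s) (i2.const_mul s),
      integral_add' (i3.const_mul b) (i4.const_mul b), integral_const_mul, integral_const_mul,
      integral_const_mul, integral_const_mul, v1, v2, v3, v4, hρI.integral_eq_one, hσ1, ← hm,
      ← hW] at hsum
    have hsW : s * W ≤ 2 * r * m * W := mul_le_mul_of_nonneg_right hs2 hW0
    refine hle.trans (hsum.le.trans ?_)
    linarith
  have hEn2 := mul_le_mul_of_nonneg_left hEn (show 0 ≤ θ / 2 * L ^ d by positivity)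
  rw [hlogC, hE] at hS
  unfold realFreeEnergy
  linarith

/-- The free energy has a minimizer. -/
lemma exists_isMinimizer {a : ℝ} {V : Torus d L → ℝ} (hV : IsInteraction a V) {θ : ℝ}
    (hθ : 0 < θ) : ∃ ρ : Torus d L → ℝ, IsMinimizer V θ ρ := by
  obtain ⟨C, hC, hCσ⟩ := exists_isBoundedDensity_le hV hθ.le
  obtain ⟨ρ, hρ, hmin⟩ := exists_isBoundedDensity_minimizer hV.integrable hθ.le hC
  refine ⟨ρ, hρ.isDensity, fun σ hσ => ?_⟩
  by_cases htop : freeEnergy V θ σ = ⊤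
  · rw [htop]
    exact le_top
  have hm := hσ.integrable.1.stronglyMeasurable_mk.measurable
  -- A representative that is measurable and nonnegative everywhere, as the mass-moving lemma
  -- demands.
  set τ : Torus d L → ℝ := fun x => max (hσ.integrable.1.mk σ x) 0 with hτ
  have hστ : σ =ᵐ[volume] τ := by
    filter_upwards [hσ.integrable.1.ae_eq_mk, hσ.nonneg] with x h1 h2
    rw [hτ]
    simp only
    rw [← h1]
    exact (max_eq_left h2).symm
  rw [freeEnergy_congr θ hστ] at htop ⊢
  have hS := integrable_mul_log_of_freeEnergy_ne_top hθ.le htop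
  have hE := integrable_energyDensity_of_freeEnergy_ne_top hθ htop
  obtain ⟨ρ', hρ', hle⟩ := hCσ τ (hm.max measurable_const) (fun x => le_max_right _ _)
    (hσ.integrable.congr hστ) ((integral_congr_ae hστ).symm.trans hσ.integral_eq_one) hS hE
  rw [freeEnergy_eq_coe θ hS hE, hρ.freeEnergy_eq hV.integrable θ, EReal.coe_le_coe_iff]
  exact (hmin ρ' hρ').trans hle

/-- For interactions of positive type the uniform density is the only minimizer. -/
lemma ae_eq_uniformDensity_of_isPositiveType {V : Torus d L → ℝ} (hV : Integrable V volume)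
    (hpos : IsPositiveType V) {θ : ℝ} (hθ : 0 ≤ θ) {ρ : Torus d L → ℝ} (hρ : IsMinimizer V θ ρ) :
    ρ =ᵐ[volume] uniformDensity d L := by
  have hL : (0 : ℝ) < L := Fact.out
  have hLd : 0 < L ^ d := pow_pos hL d
  set r : ℝ := (L ^ d)⁻¹ with hr
  have hr0 : 0 < r := inv_pos.mpr hLd
  have hu := isBoundedDensity_uniformDensity (d := d) (L := L) le_rfl
  have hle := hρ.2 _ hu.isDensity
  rw [hu.freeEnergy_eq hV θ] at hle
  have htop : freeEnergy V θ ρ ≠ ⊤ := (hle.trans_lt (EReal.coe_lt_top _)).ne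
  have hS := integrable_mul_log_of_freeEnergy_ne_top hθ htop
  -- For `θ > 0`, positive type makes the energy of `ρ` at least that of the uniform density, so
  -- minimality forces the entropy comparison. At `θ = 0` the energy may diverge, but it carries no
  -- weight.
  have hSle : ∫ x, ρ x * Real.log (ρ x) ≤
      ∫ x : Torus d L, uniformDensity d L x * Real.log (uniformDensity d L x) := by
    rcases hθ.eq_or_lt with rfl | hθ
    · rw [freeEnergy, entropy, if_pos hS] at hle
      simpa [realFreeEnergy] using hle
    · have hE := integrable_energyDensity_of_freeEnergy_ne_top hθ htop
      rw [freeEnergy_eq_coe θ hS hE, EReal.coe_le_coe_iff] at hle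
      set h : Torus d L → ℝ := fun x => -r + ρ x with hh
      have hhi : Integrable h volume := (integrable_const _).add hρ.1.integrable
      have hh0 : ∫ x, h x = 0 := by
        rw [hh, integral_add (integrable_const _) hρ.1.integrable, integral_const,
          volume_real_univ, hρ.1.integral_eq_one, smul_eq_mul, hr]
        field_simp
        ring
      have hb : ∀ᵐ _ : Torus d L, |-r| ≤ |-r| := Eventually.of_forall fun _ => le_rfl
      have hc : Integrable (fun _ : Torus d L => -r) volume := integrable_const _
      have hhh : Integrable (energyDensity V h h) volume := by
        have i1 := integrable_energyDensity_of_bdd_left hV hc.1 hb hc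
        have i2 := integrable_energyDensity_of_bdd_left hV hc.1 hb hρ.1.integrable
        have i3 := integrable_energyDensity_of_bdd_right hV hρ.1.integrable hc.1 hb
        refine (((i1.add i2).add i3).add hE).congr (Eventually.of_forall fun p => ?_)
        simp only [energyDensity, Pi.add_apply, hh]
        ring
      have h1 := hpos h hhi hh0 hhh
      have h2 := energy_const_add hV hhi hhh r
      have h3 : energy V (uniformDensity d L) (uniformDensity d L) =
          r * (∫ x, V x) := by
        have h4 := energy_const_left hV hc r
        have h5 := energy_const_left hV hu.integrable r
        rw [hu.integral_eq_one, mul_one] at h5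
        exact h5
      have h6 : (fun x => r + h x) = ρ := by
        ext x
        simp [hh]
      rw [h6, hh0, hr] at h2
      have h7 : energy V (uniformDensity d L) (uniformDensity d L) ≤ energy V ρ ρ := by
        rw [h2, h3, hr]
        have : (L ^ d)⁻¹ * (L ^ d)⁻¹ * L ^ d = (L ^ d)⁻¹ := by field_simp
        rw [this]
        linarith
      have h8 := mul_le_mul_of_nonneg_left h7 (show 0 ≤ θ / 2 * L ^ d by positivity)
      unfold realFreeEnergy at hle
      linarith
  -- The gap above the tangent at `r`. The tangent part integrates to the uniform entropy, so `D` is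
  -- nonnegative with nonpositive integral and vanishes almost everywhere; strictness of the tangent
  -- inequality then gives `ρ = r`.
  set D : Torus d L → ℝ := fun x => ρ x * Real.log (ρ x) -
    (r * Real.log r + (1 + Real.log r) * (ρ x - r)) with hD
  have hlin : Integrable (fun x => r * Real.log r + (1 + Real.log r) * (ρ x - r)) volume :=
    (integrable_const _).add ((hρ.1.integrable.sub (integrable_const r)).const_mul _)
  have hD0 : 0 ≤ᵐ[volume] D := by
    filter_upwards [hρ.1.nonneg] with x hx
    exact sub_nonneg.mpr (mul_log_tangent_le hx hr0)
  have hint : ∫ x, D x ≤ 0 := by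
    have hsub : Integrable (fun x => (1 + Real.log r) * (ρ x - r)) volume :=
      (hρ.1.integrable.sub (integrable_const r)).const_mul _
    rw [hD, integral_sub hS hlin, integral_add (integrable_const _) hsub,
      integral_const_mul (1 + Real.log r),
      integral_sub hρ.1.integrable (integrable_const r), hρ.1.integral_eq_one, integral_const,
      integral_const, volume_real_univ, smul_eq_mul, smul_eq_mul]
    have h1 : L ^ d * r = 1 := mul_inv_cancel₀ hLd.ne'
    unfold uniformDensity at hSle
    rw [integral_const, volume_real_univ, smul_eq_mul, ← hr, ← mul_assoc, h1] at hSle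
    rw [← mul_assoc, h1]
    linarith
  have hzero := (integral_eq_zero_iff_of_nonneg_ae hD0 (hS.sub hlin)).mp
    (le_antisymm hint (integral_nonneg_of_ae hD0))
  filter_upwards [hzero, hρ.1.nonneg] with x hx hx0
  by_contra hne
  have h1 := mul_log_tangent_lt hx0 hr0 hne
  simp only [hD, Pi.zero_apply] at hx
  linarith

/-- Taylor expansion to second order. The coefficient `1 / 2` is exact and fixes the threshold; the
cubic constant is merely convenient. -/
lemma one_add_mul_log_le {t : ℝ} (ht : |t| ≤ 1 / 2) :
    (1 + t) * Real.log (1 + t) ≤ t + t ^ 2 / 2 + 4 * |t| ^ 3 := by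
  have h := Real.abs_log_sub_add_sum_range_le (x := -t) (by rw [abs_neg]; linarith) 2
  rw [abs_neg, sub_neg_eq_add] at h
  simp only [Finset.sum_range_succ, Finset.sum_range_zero] at h
  norm_num at h
  have h2 : |t| ^ 3 / (1 - |t|) ≤ 2 * |t| ^ 3 := by
    rw [div_le_iff₀ (by linarith)]
    have : 0 ≤ |t| ^ 3 := by positivity
    nlinarith
  have h3 := (abs_le.mp (h.trans h2)).2
  have h4 := abs_le.mp ht
  have h5 : Real.log (1 + t) ≤ t - t ^ 2 / 2 + 2 * |t| ^ 3 := by linarith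
  have h6 := mul_le_mul_of_nonneg_left h5 (show 0 ≤ 1 + t by linarith)
  have h7 : |t ^ 3| = |t| ^ 3 := abs_pow t 3
  have h8 := neg_abs_le (t ^ 3)
  have h9 : t * |t| ^ 3 ≤ 1 / 2 * |t| ^ 3 :=
    mul_le_mul_of_nonneg_right h4.2 (by positivity)
  have h10 : 0 ≤ |t| ^ 3 := by positivity
  rw [h7] at h8
  linarith

lemma isBoundedDensity_planeWavePerturbation {n : Fin d → ℤ} (hn : n ≠ 0) {ε : ℝ} (hε : 0 < ε)
    (hε1 : ε ≤ 1) :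
    IsBoundedDensity (2 * (L ^ d)⁻¹) (planeWavePerturbation n ε : Torus d L → ℝ) where
  measurable := by
    unfold planeWavePerturbation uniformDensity
    have := (continuous_planeWave (L := L) n).measurable
    fun_prop
  mem_Icc x := by
    have hL : (0 : ℝ) < L := Fact.out
    have hr0 : 0 < (L ^ d)⁻¹ := by positivity
    have h1 := abs_le.mp (abs_planeWave_re_le n x)
    unfold planeWavePerturbation uniformDensity
    constructor
    · exact mul_nonneg hr0.le (by nlinarith)
    · rw [mul_comm]
      exact mul_le_mul_of_nonneg_right (by nlinarith) hr0.le
  integral_eq_one := by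
    have hL : (0 : ℝ) < L := Fact.out
    have hi : Integrable (fun x : Torus d L => (planeWave n x).re) volume :=
      (integrable_planeWave n).re
    unfold planeWavePerturbation uniformDensity
    rw [integral_const_mul, integral_add (integrable_const _) (hi.const_mul ε),
      integral_const_mul, integral_planeWave_re hn, integral_const, volume_real_univ]
    simp
    field_simp

/-- The squared cosine has mean `1 / 2`, so entropy and energy contribute `ε ^ 2 / 4` times `1` and
`θ * fourierReal V n`. The term `16 * ε` is the cubic entropy error, and first-order terms vanish by
mean zero. -/
lemma realFreeEnergy_planeWavePerturbation_le {V : Torus d L → ℝ} (hV : Integrable V volume)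
    (θ : ℝ) {n : Fin d → ℤ} (hn : n ≠ 0) {ε : ℝ} (hε : 0 < ε) (hε1 : ε ≤ 1 / 2) :
    realFreeEnergy V θ (planeWavePerturbation n ε) ≤ realFreeEnergy V θ (uniformDensity d L) +
      ε ^ 2 / 4 * (1 + 16 * ε + θ * fourierReal V n) := by
  have hL : (0 : ℝ) < L := Fact.out
  have hLd : 0 < L ^ d := pow_pos hL d
  set r : ℝ := (L ^ d)⁻¹ with hr
  have hr0 : 0 < r := inv_pos.mpr hLd
  have hLr : L ^ d * r = 1 := mul_inv_cancel₀ hLd.ne'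
  have hp := isBoundedDensity_planeWavePerturbation (L := L) hn hε (by linarith)
  set c : Torus d L → ℝ := fun x => (planeWave n x).re with hc
  have hci : Integrable c volume := (integrable_planeWave n).re
  have hc1 : ∀ x, |c x| ≤ 1 := abs_planeWave_re_le n
  have hc2i : Integrable (fun x => c x ^ 2) volume :=
    integrable_sq_of_bdd hci (Eventually.of_forall hc1)
  have hcint : ∫ x, c x = 0 := integral_planeWave_re hn
  have hc2int : ∫ x, c x ^ 2 = L ^ d / 2 := integral_planeWave_re_sq hn
  have hS : ∫ x : Torus d L, planeWavePerturbation n ε x *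
      Real.log (planeWavePerturbation n ε x) ≤ Real.log r + ε ^ 2 / 4 + 4 * ε ^ 3 := by
    have i1 : Integrable (fun _ : Torus d L => r * Real.log r + 4 * r * ε ^ 3) volume :=
      integrable_const _
    have i2 : Integrable (fun x => (r * ε * (Real.log r + 1)) * c x) volume := hci.const_mul _
    have i3 : Integrable (fun x => (r * ε ^ 2 / 2) * c x ^ 2) volume := hc2i.const_mul _
    have h1 := integral_mono hp.integrable_mul_log ((i1.add i2).add i3) fun x => by
      have h2 : |ε * c x| ≤ ε := by
        rw [abs_mul, abs_of_pos hε]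
        exact mul_le_of_le_one_right hε.le (hc1 x)
      have h3 := one_add_mul_log_le (h2.trans hε1)
      have h4 : |ε * c x| ^ 3 ≤ ε ^ 3 := by gcongr
      have h5 : 0 < 1 + ε * c x := by
        have := (abs_le.mp h2).1
        linarith
      have h6 : (1 + ε * c x) * Real.log (1 + ε * c x) ≤
          ε * c x + (ε * c x) ^ 2 / 2 + 4 * ε ^ 3 := by linarith
      have h7 := mul_le_mul_of_nonneg_left h6 hr0.le
      simp only [planeWavePerturbation, uniformDensity, Pi.add_apply, ← hr]
      change r * (1 + ε * c x) * Real.log (r * (1 + ε * c x)) ≤ _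
      rw [Real.log_mul hr0.ne' h5.ne']
      linarith
    rw [integral_add' (i1.add i2) i3, integral_add' i1 i2, integral_const, integral_const_mul,
      integral_const_mul, hcint, hc2int, volume_real_univ, smul_eq_mul] at h1
    refine h1.trans (le_of_eq ?_)
    linear_combination (Real.log r + 4 * ε ^ 3 + ε ^ 2 / 4) * hLr
  have hE : energy V (planeWavePerturbation n ε) (planeWavePerturbation n ε) =
      energy V (uniformDensity d L) (uniformDensity d L) +
        (r * ε) ^ 2 * (L ^ d / 2 * fourierReal V n) := by
    have e1 : (planeWavePerturbation n ε : Torus d L → ℝ) = fun x => r + r * ε * c x := by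
      ext x
      simp only [planeWavePerturbation, uniformDensity, ← hr, hc]
      ring
    have hcE := integrable_energyDensity_of_bdd_left hV hci.1 (Eventually.of_forall hc1) hci
    have e2 : energyDensity V (fun x => r * ε * c x) (fun x => r * ε * c x) =
        fun p => (r * ε) ^ 2 * energyDensity V c c p := by
      ext p
      simp only [energyDensity]
      ring
    have e3 : energy V (fun x => r * ε * c x) (fun x => r * ε * c x) =
        (r * ε) ^ 2 * energy V c c := by
      unfold energy
      rw [e2, integral_const_mul]
    have i0 : Integrable (fun x => r * ε * c x) volume := hci.const_mul _
    have u : uniformDensity d L = fun _ => r := rfl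
    rw [e1, energy_const_add hV i0 (by rw [e2]; exact hcE.const_mul _), e3,
      energy_planeWave_re hV hn, integral_const_mul, hcint, u,
      energy_const_left hV (integrable_const r), integral_const, volume_real_univ, smul_eq_mul]
    ring
  have hu : ∫ x : Torus d L, uniformDensity d L x * Real.log (uniformDensity d L x) =
      Real.log r := by
    unfold uniformDensity
    rw [integral_const, volume_real_univ, smul_eq_mul, ← hr]
    linear_combination Real.log r * hLr
  unfold realFreeEnergy
  rw [hE, hu]
  have h9 : θ / 2 * L ^ d * ((r * ε) ^ 2 * (L ^ d / 2 * fourierReal V n)) =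
      ε ^ 2 / 4 * (θ * fourierReal V n) := by
    linear_combination (ε ^ 2 / 4 * (θ * fourierReal V n)) * (L ^ d * r + 1) * hLr
  linarith

lemma exists_planeWavePerturbation_lt {V : Torus d L → ℝ} (hV : Integrable V volume)
    {n : Fin d → ℤ} (hn : n ≠ 0) (hneg : fourierReal V n < 0) {θ : ℝ} (hθ : thetaSharp V n < θ) :
    ∃ ε₀ : ℝ, 0 < ε₀ ∧ ∀ ε : ℝ, 0 < ε → ε < ε₀ →
      IsDensity (planeWavePerturbation n ε : Torus d L → ℝ) ∧
      freeEnergy V θ (planeWavePerturbation n ε) < freeEnergy V θ (uniformDensity d L) := by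
  have h1 : θ * fourierReal V n < -1 := by
    rw [thetaSharp, abs_of_neg hneg, inv_lt_iff_one_lt_mul₀ (neg_pos.mpr hneg)] at hθ
    linarith
  -- The first bound validates the logarithm expansion; the second is exactly the condition `1 + 16
  -- * ε + θ * fourierReal V n < 0`.
  refine ⟨min (1 / 2) ((-1 - θ * fourierReal V n) / 16), lt_min (by norm_num) (by linarith),
    fun ε hε hε0 => ?_⟩
  have h2 := hε0.trans_le (min_le_left _ _)
  have h3 := hε0.trans_le (min_le_right _ _)
  have hp := isBoundedDensity_planeWavePerturbation (L := L) hn hε (by linarith)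
  refine ⟨hp.isDensity, ?_⟩
  rw [hp.freeEnergy_eq hV θ, (isBoundedDensity_uniformDensity le_rfl).freeEnergy_eq hV θ,
    EReal.coe_lt_coe_iff]
  have h4 := realFreeEnergy_planeWavePerturbation_le hV θ hn hε h2.le
  have h5 : ε ^ 2 / 4 * (1 + 16 * ε + θ * fourierReal V n) < 0 :=
    mul_neg_of_pos_of_neg (by positivity) (by linarith)
  linarith

/-- A minimizer exists, and the perturbation beats the uniform density, so that minimizer is
nontrivial. Any negative coefficient at a nonzero wave vector will do, minimal or not. -/
lemma phase_transition_of_fourierReal_neg {a : ℝ} {V : Torus d L → ℝ} (hV : IsInteraction a V)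
    {n : Fin d → ℤ} (hn : n ≠ 0) (hneg : fourierReal V n < 0) {θ : ℝ} (hθ : thetaSharp V n < θ) :
    HasNontrivialMinimizer V θ ∧ ¬ IsMinimizer V θ (uniformDensity d L) := by
  obtain ⟨ε₀, hε₀, hlt⟩ := exists_planeWavePerturbation_lt hV.integrable hn hneg hθ
  obtain ⟨hd, hε⟩ := hlt (ε₀ / 2) (half_pos hε₀) (half_lt_self hε₀)
  have hθ0 : 0 < θ := lt_of_le_of_lt (inv_nonneg.mpr (abs_nonneg _)) hθ
  obtain ⟨ρ, hρ⟩ := exists_isMinimizer hV hθ0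
  refine ⟨⟨ρ, hρ, fun h => ?_⟩, fun h => (h.2 _ hd).not_gt hε⟩
  have := hρ.2 _ hd
  rw [freeEnergy_congr θ h] at this
  exact this.not_gt hε

end

end McKeanVlasov

open McKeanVlasov
theorem mainTheorem3 {d : ℕ} (hd : 1 ≤ d) {L : ℝ} [Fact (0 < L)] {a : ℝ} (haL : a < L)
    (V : Torus d L → ℝ) (hV : IsInteraction a V) :
    (IsNonPositiveInteraction a V →
      (∃ n : Fin d → ℤ, IsMinimizingWaveVector V n) ∧
      ∀ n : Fin d → ℤ, IsMinimizingWaveVector V n →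
        fourierReal V n < 0 ∧
        ∀ θ : ℝ, thetaSharp V n < θ →
          HasNontrivialMinimizer V θ ∧
          ¬ IsMinimizer V θ (uniformDensity d L) ∧
          ∃ ε₀ : ℝ, 0 < ε₀ ∧ ∀ ε : ℝ, 0 < ε → ε < ε₀ →
            IsDensity (planeWavePerturbation n ε : Torus d L → ℝ) ∧
            freeEnergy V θ (planeWavePerturbation n ε) < freeEnergy V θ (uniformDensity d L)) ∧
    (IsNonPositiveInteraction a V ↔ ∃ θ : ℝ, 0 ≤ θ ∧ HasNontrivialMinimizer V θ) := by
  refine ⟨fun h => ?_, fun h => ?_, ?_⟩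
  · obtain ⟨m, hm, hVm⟩ := exists_fourierReal_neg hV.integrable h.2
    refine ⟨exists_isMinimizingWaveVector hV.integrable hm hVm, fun n hn => ?_⟩
    have hneg : fourierReal V n < 0 := (hn.2 m hm).trans_lt hVm
    refine ⟨hneg, fun θ hθ => ?_⟩
    obtain ⟨h1, h2⟩ := phase_transition_of_fourierReal_neg hV hn.1 hneg hθ
    exact ⟨h1, h2, exists_planeWavePerturbation_lt hV.integrable hn.1 hneg hθ⟩
  · obtain ⟨m, hm, hVm⟩ := exists_fourierReal_neg hV.integrable h.2
    have h0 : 0 ≤ thetaSharp V m := inv_nonneg.mpr (abs_nonneg _)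
    exact ⟨thetaSharp V m + 1, by linarith,
      (phase_transition_of_fourierReal_neg hV hm hVm (lt_add_one _)).1⟩
  · rintro ⟨θ, hθ, ρ, hρ, hne⟩
    exact ⟨hV, fun hpos =>
      hne (ae_eq_uniformDensity_of_isPositiveType hV.integrable hpos hθ hρ)⟩
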